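/- **Setting.** Let $A=(A_{p,p'})_{p,p'\in\mathbb Z^2}$ be a real matrix with $\sum_p|A_{p,0}|<\infty$, and put $\hat A(k)=\sum_{p\in\mathbb Z^2}A_{p,0}e^{-ip\cdot k}$ and $\hat R(k)=\hat A(k)+\hat A(-k)$ for $k\in\mathbb R^2$. Assume: 1. $A_{p,p'}=A_{p+r,p'+r}$ for all $p,p',r$; 2. $\hat A(0)=\sum_{p'}A_{p,p'}=0$; 3. $\hat R(k)\le 0$ for all $k$, and the only zero of $\hat R$ on $[-\pi,\pi]^2$ is $k=0$; 4. $\hat R(k)=(k,\hat Wk)+O(|k|^3)$ as $k\to0$, with $\hat W$ a symmetric, strictly negative definite $2\times2$ matrix; 5. $\hat A$ is $2\pi$-periodic in each coordinate and $C^\infty$. Let $v>0$, let $w>0$ be given by $w^2=\det\hat W$, let $V$ be a real $2\times 2$ matrix with $V\hat WV^T=-I$, and let $U=i\nabla\hat A(0)\in\mathbb R^2$. For integers $0<m_2<m$ let $\mathcal R_m$ be the quotient of $\mathbb Z^2$ by the subgroup $\{(j_1m-j_2m_2,\,j_2m):j_1,j_2\in\mathbb Z\}$, which has $m^2$ elements,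 and let $A_{p,p'}$ for $p,p'\in\mathcal R_m$ denote the periodized matrix $\sum_{r}A_{r,0}$, the sum being over the $r\in\mathbb Z^2$ whose class is $p-p'$. Given $\bar\xi\in\mathbb R^{\mathcal R_m}$, let $(\xi_{p,t})_{p\in\mathcal R_m,\,t\ge0}$ be the (continuous) solution of $$d\xi_{p,t}=\sqrt v\,dB_{p,t}+\sum_{p'\in\mathcal R_m}A_{p,p'}\,\xi_{p',t}\,dt,\qquad \xi_{p,0}=\bar\xi_p ,$$ where the $B_p$, $p\in\mathcal R_m$, are independent standard Brownian motions, and set $$\mathcal W^{\bar\xi}_{p,p'}(t,s)=\mathbb E[\xi_{p,t}\xi_{p',s}]-\mathbb E[\xi_{p,t}]\,\mathbb E[\xi_{p',s}],\qquad t,s\ge0 .$$ **Theorem.** All $\xi_{p,t}$ are square integrable, and for every $y\in\mathbb Z^2$ and $t,s\ge0$ the quantity $\mathcal W^{\bar\xi}_{p,p+y}(t,s)$ depends neither on $\bar\xi$ nor on $p$. For every $y\in\mathbb Z^2$ and $t,s\ge0$ the limit $$\mathbb W_y(t,s)=\lim_{m\to\infty}\mathcal W^{\bar\xi}_{p,p+y}(t,s)$$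 exists, for every choice of $m_2=m_2(m)$ with $0<m_2<m$ for all large $m$, and does not depend on that choice. Moreover, for all $t\ge s\ge0$ and $y\in\mathbb Z^2$, $$\mathbb W_y(t,s)=\frac{v}{4\pi w}\int_{1+(t-s)/2}^{1+(t+s)/2}\frac{e^{-|H|^2/(4a)}}{a}\,da+j(t,s,y),\qquad H=Vy+(t-s)VU ,$$ where $$\sup_{t\ge s\ge0,\;y\in\mathbb Z^2}|j(t,s,y)|<\infty ,$$ and $j(t,s,y)\to0$ as $\max(t-s,|y|)\to\infty$, uniformly in $t\ge s\ge 0$ and $y\in\mathbb Z^2$: for every $\varepsilon>0$ there is $r$ such that $|j(t,s,y)|<\varepsilon$ whenever $t\ge s\ge0$, $y\in\mathbb Z^2$ and $\max(t-s,|y|)\ge r$. -/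

import Mathlib

open Filter MeasureTheory ProbabilityTheory Asymptotics
open scoped Topology NNReal Matrix

noncomputable section

namespace LinSDE

/-- Particle labels in infinite volume: the lattice `ℤ²`. -/
abbrev Site : Type := Fin 2 → ℤ

/-- The real vector associated with a lattice site. -/
def toVec (y : Site) : Fin 2 → ℝ := fun i => (y i : ℝ)

/-- Euclidean length of a lattice site. -/
def siteNorm (y : Site) : ℝ := √(∑ i, (y i : ℝ) ^ 2)

/-- The vectors `(j₁ m - j₂ m₂, j₂ m)`, `j₁, j₂ ∈ ℤ`: labels that differ by such a vector are
identified in the finite system. -/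
def periods (m m₂ : ℕ) : AddSubgroup Site where
  carrier := {x | ∃ j₁ j₂ : ℤ, x = ![j₁ * m - j₂ * m₂, j₂ * m]}
  zero_mem' := ⟨0, 0, by ext i; fin_cases i <;> simp⟩
  add_mem' := by
    rintro _ _ ⟨a, b, rfl⟩ ⟨c, d, rfl⟩
    exact ⟨a + c, b + d, by ext i; fin_cases i <;> simp <;> ring⟩
  neg_mem' := by
    rintro _ ⟨a, b, rfl⟩
    exact ⟨-a, -b, by ext i; fin_cases i <;> simp; ring⟩

/-- The twisted torus `R_m` of labels: `ℤ²` modulo the periods. -/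
abbrev Torus (m m₂ : ℕ) : Type := Site ⧸ periods m m₂

/-- The label set is finite, so that finite sums over it carry no junk value. -/
theorem finite_torus {m : ℕ} (hm : 0 < m) (m₂ : ℕ) : Finite (Torus m m₂) := by
  have hm' : (0 : ℤ) < m := by exact_mod_cast hm
  let f : (Set.Ico (0 : ℤ) m) × (Set.Ico (0 : ℤ) m) → Torus m m₂ :=
    fun q => QuotientAddGroup.mk (![(q.1 : ℤ), (q.2 : ℤ)] : Site)
  refine Finite.of_surjective f ?_
  intro p
  obtain ⟨x, rfl⟩ := QuotientAddGroup.mk_surjective p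
  have hb : x 1 = x 1 % m + m * (x 1 / m) := (Int.emod_add_mul_ediv _ _).symm
  set e : ℤ := x 1 / m with he
  set z : ℤ := x 0 + e * m₂ with hz
  have ha : z = z % m + m * (z / m) := (Int.emod_add_mul_ediv _ _).symm
  refine ⟨⟨⟨z % m, Int.emod_nonneg _ hm'.ne', Int.emod_lt_of_pos _ hm'⟩,
    ⟨x 1 % m, Int.emod_nonneg _ hm'.ne', Int.emod_lt_of_pos _ hm'⟩⟩, ?_⟩
  refine QuotientAddGroup.eq.2 ⟨z / m, e, ?_⟩
  ext i
  fin_cases i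
  · simp
    linarith
  · simp
    linarith

/-- The symbol `Â(k) = ∑_p A_{p,0} e^{-i p·k}`, `k ∈ ℝ²`. -/
def symbol (A : Site → Site → ℝ) (k : Fin 2 → ℝ) : ℂ :=
  ∑' p : Site, (A p 0 : ℂ) * Complex.exp (-Complex.I * ((toVec p ⬝ᵥ k : ℝ) : ℂ))

/-- `R̂(k) = Â(k) + Â(-k)`, a real number by `ofReal_symR`. -/
def symR (A : Site → Site → ℝ) (k : Fin 2 → ℝ) : ℝ := (symbol A k + symbol A (-k)).re

theorem symbol_neg (A : Site → Site → ℝ) (k : Fin 2 → ℝ) :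
    symbol A (-k) = (starRingEnd ℂ) (symbol A k) := by
  unfold symbol
  rw [Complex.conj_tsum]
  refine tsum_congr fun p => ?_
  rw [map_mul, ← Complex.exp_conj]
  congr 2
  · simp
  · rw [map_mul, map_neg, Complex.conj_I, Complex.conj_ofReal, dotProduct_neg]
    push_cast
    ring

theorem ofReal_symR (A : Site → Site → ℝ) (k : Fin 2 → ℝ) :
    (symR A k : ℂ) = symbol A k + symbol A (-k) := by
  apply Complex.ext <;> simp [symR, symbol_neg]

/-- `U = i ∇Â(0)`, a real vector by `ofReal_velU`. -/
def velU (A : Site → Site → ℝ) : Fin 2 → ℝ :=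
  fun i => (Complex.I * fderiv ℝ (symbol A) 0 (Pi.single i 1)).re

theorem ofReal_velU (A : Site → Site → ℝ) (i : Fin 2) :
    (velU A i : ℂ) = Complex.I * fderiv ℝ (symbol A) 0 (Pi.single i 1) := by
  have h1 : (fun k => symbol A (-k)) = Complex.conjCLE ∘ symbol A := by
    funext k
    simp [symbol_neg]
  have h2 : fderiv ℝ (fun k => symbol A (-k)) 0 = -fderiv ℝ (symbol A) 0 := by
    simpa using fderiv_comp_smul (𝕜 := ℝ) (f := symbol A) (x := (0 : Fin 2 → ℝ)) (-1 : ℝ)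
  rw [h1, ContinuousLinearEquiv.comp_fderiv] at h2
  have h3 := congrArg (fun L : (Fin 2 → ℝ) →L[ℝ] ℂ => (L (Pi.single i 1)).re) h2
  simp at h3
  apply Complex.ext
  · simp [velU]
  · simp
    linarith

/-- The standing assumptions on the infinite real matrix `A` (indexed by `ℤ²`), together with the
symmetric matrix `What` of the quadratic part of `R̂` at the origin. -/
structure DriftProperties (A : Site → Site → ℝ) (What : Matrix (Fin 2) (Fin 2) ℝ) : Prop where
  /-- The series defining the symbol converges absolutely. -/
  summable : Summable fun p => A p 0
  /-- (1) Translation invariance. -/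
  translation : ∀ p p' r, A p p' = A (p + r) (p' + r)
  /-- (2) `Â(0) = ∑_{p'} A_{p,p'} = 0`. -/
  symbol_zero : symbol A 0 = 0 ∧ ∀ p, HasSum (fun p' => A p p') 0
  /-- (3) `R̂ ≤ 0`, and its only zero in `[-π, π]²` is the origin. -/
  symR_nonpos : ∀ k, symR A k ≤ 0
  symR_zero : ∀ k, (∀ i, k i ∈ Set.Icc (-Real.pi) Real.pi) → symR A k = 0 → k = 0
  /-- (4) `What` is symmetric and strictly negative definite, and
  `R̂(k) = (k, What k) + O(|k|³)` as `k → 0`. -/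
  negDef : (-What).PosDef
  expansion : (fun k => symR A k - k ⬝ᵥ (What *ᵥ k)) =O[𝓝 0] fun k => ‖k‖ ^ 3
  /-- (5) The symbol is `2π`-periodic and smooth. -/
  periodic : ∀ k i, symbol A (k + Pi.single i (2 * Real.pi)) = symbol A k
  smooth : ContDiff ℝ (⊤ : ℕ∞) (symbol A)

/-- The matrix of the finite system: `A_{p,p'}` for `p, p'` in the torus is the sum of the
entries of the infinite translation-invariant matrix over the representatives of `p - p'`. -/
def torusMatrix (A : Site → Site → ℝ) (m m₂ : ℕ) (p p' : Torus m m₂) : ℝ :=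
  ∑' r : {r : Site // (QuotientAddGroup.mk r : Torus m m₂) = p - p'}, A r 0

/-- `ξ` solves `dξ_p = √v dB_p + ∑_{p'} A_{p,p'} ξ_{p'} dt`, `ξ_{p,0} = ξbar_p`, on the torus of
labels, for some independent standard Brownian motions `B_p`. As the noise is additive, the
system is written in integrated form along almost every path. -/
structure IsSolution {Ω : Type*} [MeasurableSpace Ω] (μ : Measure Ω) (A : Site → Site → ℝ)
    (v : ℝ) (m m₂ : ℕ) (ξbar : Torus m m₂ → ℝ) (ξ : Torus m m₂ → ℝ≥0 → Ω → ℝ) : Prop where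
  aemeasurable : ∀ p t, AEMeasurable (ξ p t) μ
  continuous : ∀ᵐ ω ∂μ, ∀ p, Continuous fun t => ξ p t ω
  equation : ∃ B : Torus m m₂ → ℝ≥0 → Ω → ℝ,
    (∀ p, IsBrownianReal (B p) μ) ∧
    iIndepFun (fun p ω t => B p t ω) μ ∧
    ∀ᵐ ω ∂μ, ∀ p, ∀ t : ℝ≥0,
      ξ p t ω = ξbar p + √v * B p t ω
        + ∫ u in (0 : ℝ)..t, ∑ᶠ p', torusMatrix A m m₂ p p' * ξ p' u.toNNReal ω

/-- `M_p(t) = E[ξ_{p,t}]`. -/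
def meanM {Ω ι : Type*} [MeasurableSpace Ω] (μ : Measure Ω) (ξ : ι → ℝ≥0 → Ω → ℝ)
    (p : ι) (t : ℝ≥0) : ℝ :=
  ∫ ω, ξ p t ω ∂μ

/-- `C_{p,p'}(t,s) = E[ξ_{p,t} ξ_{p',s}]`. -/
def corrC {Ω ι : Type*} [MeasurableSpace Ω] (μ : Measure Ω) (ξ : ι → ℝ≥0 → Ω → ℝ)
    (p p' : ι) (t s : ℝ≥0) : ℝ :=
  ∫ ω, ξ p t ω * ξ p' s ω ∂μ

/-- The centred space-time covariance `W_{p,p'}(t,s) = C_{p,p'}(t,s) - M_p(t) M_{p'}(s)`. -/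
def covW {Ω ι : Type*} [MeasurableSpace Ω] (μ : Measure Ω) (ξ : ι → ℝ≥0 → Ω → ℝ)
    (p p' : ι) (t s : ℝ≥0) : ℝ :=
  corrC μ ξ p p' t s - meanM μ ξ p t * meanM μ ξ p' s

/-- `H = V y + (t - s) V U`. -/
def vecH (A : Site → Site → ℝ) (V : Matrix (Fin 2) (Fin 2) ℝ) (t s : ℝ≥0) (y : Site) :
    Fin 2 → ℝ :=
  V *ᵥ toVec y + ((t : ℝ) - s) • (V *ᵥ velU A)

/-- The leading term
`v / (4πw) ∫_{1+(t-s)/2}^{1+(t+s)/2} e^{-|H|²/(4a)} / a da`, with `|H|` the Euclidean norm. -/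
def leadingTerm (A : Site → Site → ℝ) (V : Matrix (Fin 2) (Fin 2) ℝ) (v w : ℝ) (t s : ℝ≥0)
    (y : Site) : ℝ :=
  v / (4 * Real.pi * w) *
    ∫ a in (1 + ((t : ℝ) - s) / 2)..(1 + ((t : ℝ) + s) / 2),
      Real.exp (-(∑ i, vecH A V t s y i ^ 2) / (4 * a)) / a

end LinSDE

end

/-! The drift commutes with translations, so the characters of the finite torus decouple the system:
each Fourier mode solves a scalar linear equation whose rate is the symbol `Â` at the frequency `k`
of the character. Variation of constants writes the solution as a deterministic term, which carries
the initial data, plus a linear functional of the Brownian motions. For `s ≤ t` the covariance is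
therefore `v` times the average over the characters of `e^{-iy·k} e^{(t-s)Â(k)} ∫_0^s e^{R̂(k)u}
du`; neither the initial condition nor `p` enters (`memLp_and_covW_eq_finiteCov`). The frequencies
equidistribute as `m → ∞` whatever `m₂` is, since a nonzero period has a coordinate of size at least
`m` (`tendsto_charAverage`). The limit is the same expression integrated over `(-π, π]²`
(`limitCov_eq`).

The leading term is this Fourier integral with `Â` replaced by `-iU·k - q(k)/2`, where `q(k) = -(k,
Ŵk)`, taken over the whole plane with the extra cutoff `e^{-q}`; the cutoff is the shift by `1` in
the limits of the `a`-integral (`leadingTerm_eq`). So `j` is, up to a constant, the Fourier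
transform of a difference. As `s` grows, each of its two terms approaches size `|k|^{-2}` at the
origin, which is not integrable in the plane and produces the logarithm. The difference gains one
power of `|k|`: `R̂ + q` is cubic by assumption, and `Im Â + U·k` is cubic because `Im Â` is odd.
The result is an integrable bound of order `1/|k|` at the origin, uniform in both times
(`exists_dominating`), whence `j` is bounded.

For the decay, the times are compactified to `[0, ∞]²`. If `t - s → ∞`, the difference tends to zero
pointwise and dominated convergence applies. Otherwise, along a subsequence, the difference
converges in `L¹` while `|y| → ∞`, and the Riemann–Lebesgue lemma applies to its limit
(`tendsto_remainder`, `exists_remainder_lt`). -/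

/-! ### Scalar linear equations with continuous forcing. -/

namespace LinSDE

/-- The response at time `t` of the linear equation `dx = lam x dt + df`, `x 0 = 0`, written
without derivatives of the forcing `f`. -/
noncomputable def ouPath (lam : ℂ) (f : ℝ≥0 → ℂ) (t : ℝ≥0) : ℂ :=
  f t + lam * ∫ u in (0 : ℝ)..t, Complex.exp (lam * (t - u)) * f u.toNNReal

theorem hasDerivAt_cexp_mul_ofReal (a : ℂ) (u : ℝ) :
    HasDerivAt (fun u : ℝ => Complex.exp (a * u)) (a * Complex.exp (a * u)) u := by
  have h := ((hasDerivAt_id (u : ℂ)).const_mul a).cexp.comp_ofReal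
  simpa [mul_comm] using h

/-- Variation of constants. -/
theorem eq_exp_add_ouPath {lam x₀ : ℂ} {X f : ℝ≥0 → ℂ} (hX : Continuous X) (hf : Continuous f)
    (h : ∀ t : ℝ≥0, X t = x₀ + f t + lam * ∫ u in (0 : ℝ)..t, X u.toNNReal) (t : ℝ≥0) :
    X t = Complex.exp (lam * t) * x₀ + ouPath lam f t := by
  have hX' : Continuous fun u : ℝ => X u.toNNReal := by fun_prop
  have hf' : Continuous fun u : ℝ => f u.toNNReal := by fun_prop
  set J : ℝ → ℂ := fun t => ∫ u in (0 : ℝ)..t, X u.toNNReal with hJ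
  have hJd : ∀ u, HasDerivAt J (X u.toNNReal) u := fun u =>
    intervalIntegral.integral_hasDerivAt_right (hX'.intervalIntegrable _ _)
      (hX'.stronglyMeasurableAtFilter _ _) hX'.continuousAt
  -- `X` need not be differentiable, but its primitive `J` is, so the integrating factor is applied
  -- to `J`.
  have hd : ∀ u ∈ Set.uIcc (0 : ℝ) t, HasDerivAt (fun u : ℝ => Complex.exp (-lam * u) * J u)
      (Complex.exp (-lam * u) * (x₀ + f u.toNNReal)) u := by
    intro u hu
    rw [Set.uIcc_of_le t.coe_nonneg] at hu
    refine ((hasDerivAt_cexp_mul_ofReal (-lam) u).mul (hJd u)).congr_deriv ?_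
    have := h u.toNNReal
    rw [Real.coe_toNNReal _ hu.1] at this
    rw [this]
    simp only [hJ]
    ring
  have key := intervalIntegral.integral_eq_sub_of_hasDerivAt hd
    (Continuous.intervalIntegrable (by fun_prop) _ _)
  have hd2 : ∀ u ∈ Set.uIcc (0 : ℝ) t, HasDerivAt (fun u : ℝ => Complex.exp (-lam * u))
      (-lam * Complex.exp (-lam * u)) u := fun u _ => hasDerivAt_cexp_mul_ofReal (-lam) u
  have key2 := intervalIntegral.integral_eq_sub_of_hasDerivAt hd2
    (Continuous.intervalIntegrable (by fun_prop) _ _)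
  have hJ0 : J 0 = 0 := by simp [hJ]
  have hsplit : ∫ u in (0 : ℝ)..t, Complex.exp (-lam * u) * (x₀ + f u.toNNReal)
      = (∫ u in (0 : ℝ)..t, Complex.exp (-lam * u)) * x₀
        + ∫ u in (0 : ℝ)..t, Complex.exp (-lam * u) * f u.toNNReal := by
    simp_rw [mul_add]
    rw [intervalIntegral.integral_add (Continuous.intervalIntegrable (by fun_prop) _ _)
      (Continuous.intervalIntegrable (by fun_prop) _ _), intervalIntegral.integral_mul_const]
  have hpull : ∫ u in (0 : ℝ)..t, Complex.exp (lam * (t - u)) * f u.toNNReal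
      = Complex.exp (lam * t) * ∫ u in (0 : ℝ)..t, Complex.exp (-lam * u) * f u.toNNReal := by
    rw [← intervalIntegral.integral_const_mul]
    refine intervalIntegral.integral_congr fun u _ => ?_
    rw [← mul_assoc, ← Complex.exp_add]
    ring_nf
  rw [intervalIntegral.integral_const_mul] at key2
  have hexp : Complex.exp (lam * t) * Complex.exp (-lam * (t : ℝ)) = 1 := by
    rw [← Complex.exp_add]
    simp
  rw [h t, ouPath, hpull]
  change x₀ + f t + lam * J t = _
  rw [hsplit, hJ0] at key
  simp only [mul_zero, sub_zero, Complex.ofReal_zero, Complex.exp_zero] at key key2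
  linear_combination -(Complex.exp (lam * t) * lam) * key - lam * J t * hexp
    - Complex.exp (lam * t) * x₀ * key2 - x₀ * hexp

theorem ouPath_sum {ι : Type*} (s : Finset ι) (lam : ℂ) (c : ι → ℂ) (f : ι → ℝ≥0 → ℂ)
    (hf : ∀ i, Continuous (f i)) (t : ℝ≥0) :
    ouPath lam (fun u => ∑ i ∈ s, c i * f i u) t = ∑ i ∈ s, c i * ouPath lam (f i) t := by
  simp only [ouPath, mul_add, Finset.sum_add_distrib]
  congr 1
  simp_rw [Finset.mul_sum]
  rw [intervalIntegral.integral_finsetSum]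
  · rw [Finset.mul_sum]
    refine Finset.sum_congr rfl fun i _ => ?_
    rw [mul_left_comm, ← intervalIntegral.integral_const_mul (c i)]
    simp only [mul_left_comm]
  · intro i _
    have := hf i
    exact Continuous.intervalIntegrable (by fun_prop) _ _

/-- For a forcing with density `g`, switched off after time `u`, integration by parts turns `ouPath`
into the usual Duhamel integral. It is the tool for applying the response operator to `min u r`,
once in each variable. -/
theorem ouPath_integral_min {g : ℝ → ℂ} (hg : Continuous g) (mu : ℂ) (u s : ℝ≥0) :
    ouPath mu (fun r => ∫ x in (0 : ℝ)..min u r, g x) s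
      = ∫ x in (0 : ℝ)..min u s, Complex.exp (mu * (s - x)) * g x := by
  set f : ℝ → ℂ := fun r => ∫ x in (0 : ℝ)..min (u : ℝ) r, g x with hf
  have hG : Continuous fun r : ℝ => ∫ x in (0 : ℝ)..r, g x :=
    intervalIntegral.continuous_primitive (fun a b => hg.intervalIntegrable a b) 0
  have hfc : Continuous f := hG.comp (by fun_prop)
  have hval : ∀ r ∈ Set.uIcc (0 : ℝ) s, ∫ x in (0 : ℝ)..min u r.toNNReal, g x = f r := by
    intro r hr
    rw [Set.uIcc_of_le s.coe_nonneg] at hr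
    simp [hf, max_eq_left hr.1]
  set m : ℝ := min (u : ℝ) s with hm
  have hm0 : 0 ≤ m := le_min u.2 s.2
  have hms : m ≤ s := min_le_right _ _
  have hmu : m ≤ u := min_le_left _ _
  have hE : ∀ c : ℝ, HasDerivAt (fun u : ℝ => Complex.exp (mu * (s - u)))
      (-mu * Complex.exp (mu * (s - c))) c := by
    intro c
    have h := (((hasDerivAt_id (c : ℂ)).const_sub (s : ℂ)).const_mul mu).cexp.comp_ofReal
    simpa [mul_comm] using h
  have hGd : ∀ c, HasDerivAt (fun r : ℝ => ∫ x in (0 : ℝ)..r, g x) (g c) c := fun c =>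
    intervalIntegral.integral_hasDerivAt_right (hg.intervalIntegrable _ _)
      (hg.stronglyMeasurableAtFilter _ _) hg.continuousAt
  -- The forcing is the primitive of `g` up to `m = min u s` and constant from `m` to `s`; on each
  -- piece the integrand is an exact derivative.
  have h1 : ∫ r in (0 : ℝ)..m, Complex.exp (mu * (s - r)) * (g r - mu * f r)
      = Complex.exp (mu * (s - m)) * f m := by
    have hd : ∀ c ∈ Set.uIcc (0 : ℝ) m, HasDerivAt
        (fun r : ℝ => Complex.exp (mu * (s - r)) * ∫ x in (0 : ℝ)..r, g x)
        (Complex.exp (mu * (s - c)) * (g c - mu * f c)) c := by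
      intro c hc
      rw [Set.uIcc_of_le hm0] at hc
      refine ((hE c).mul (hGd c)).congr_deriv ?_
      simp only [hf, min_eq_right (hc.2.trans hmu)]
      ring
    rw [intervalIntegral.integral_eq_sub_of_hasDerivAt hd
      (Continuous.intervalIntegrable (by fun_prop) _ _)]
    simp [hf, min_eq_right hmu]
  have h2 : ∫ r in m..(s : ℝ), Complex.exp (mu * (s - r)) * (mu * f r)
      = (Complex.exp (mu * (s - m)) - 1) * f m := by
    have hd : ∀ c ∈ Set.uIcc m (s : ℝ), HasDerivAt
        (fun r : ℝ => -Complex.exp (mu * (s - r)) * f m)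
        (Complex.exp (mu * (s - c)) * (mu * f c)) c := by
      intro c hc
      rw [Set.uIcc_of_le hms] at hc
      refine ((hE c).neg.mul_const (f m)).congr_deriv ?_
      have : f c = f m := by
        simp only [hf]
        congr 1
        rcases le_total (u : ℝ) s with h | h
        · rw [hm, min_eq_left h] at hc ⊢
          simp [hc.1]
        · have : c = s := by rw [hm, min_eq_right h] at hc; exact le_antisymm hc.2 hc.1
          subst this
          simp [hm]
      rw [this]
      ring
    rw [intervalIntegral.integral_eq_sub_of_hasDerivAt hd
      (Continuous.intervalIntegrable (by fun_prop) _ _)]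
    simp
    ring
  have h3 : ∫ r in (0 : ℝ)..s, Complex.exp (mu * (s - r)) * f r
      = (∫ r in (0 : ℝ)..m, Complex.exp (mu * (s - r)) * f r)
        + ∫ r in m..(s : ℝ), Complex.exp (mu * (s - r)) * f r :=
    (intervalIntegral.integral_add_adjacent_intervals
      (Continuous.intervalIntegrable (by fun_prop) _ _)
      (Continuous.intervalIntegrable (by fun_prop) _ _)).symm
  have h4 : ∫ r in (0 : ℝ)..m, Complex.exp (mu * (s - r)) * (g r - mu * f r)
      = (∫ r in (0 : ℝ)..m, Complex.exp (mu * (s - r)) * g r)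
        - mu * ∫ r in (0 : ℝ)..m, Complex.exp (mu * (s - r)) * f r := by
    rw [← intervalIntegral.integral_const_mul, ← intervalIntegral.integral_sub
      (Continuous.intervalIntegrable (by fun_prop) _ _)
      (Continuous.intervalIntegrable (by fun_prop) _ _)]
    refine intervalIntegral.integral_congr fun r _ => ?_
    ring
  have h5 : ∫ r in m..(s : ℝ), Complex.exp (mu * (s - r)) * (mu * f r)
      = mu * ∫ r in m..(s : ℝ), Complex.exp (mu * (s - r)) * f r := by
    rw [← intervalIntegral.integral_const_mul]
    refine intervalIntegral.integral_congr fun r _ => ?_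
    ring
  have h6 : f s = f m := by simp [hf, hm]
  have h7 : ∫ r in (0 : ℝ)..s, Complex.exp (mu * (s - r)) * ∫ x in (0 : ℝ)..min u r.toNNReal, g x
      = ∫ r in (0 : ℝ)..s, Complex.exp (mu * (s - r)) * f r :=
    intervalIntegral.integral_congr fun r hr => by rw [hval r hr]
  have h8 : ∫ x in (0 : ℝ)..min u s, g x = f m := by simp [hf, hm]
  simp only [ouPath]
  rw [h7, h8, h3]
  rw [h5] at h2
  rw [h4] at h1
  linear_combination h2 - h1

/-- `∫_0^{t ∧ s} e^{lam (t - r) + mu (s - r)} dr`. -/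
noncomputable def ouCov (lam mu : ℂ) (t s : ℝ≥0) : ℂ :=
  ∫ r in (0 : ℝ)..min t s, Complex.exp (lam * (t - r)) * Complex.exp (mu * (s - r))

/-- `min u r` is the covariance of Brownian motion, so the left side is what the covariance of two
responses reduces to. The inner response has density `1`, the outer one density `e^{mu (s - x)}`. -/
theorem ouPath_ouPath_min (lam mu : ℂ) (t s : ℝ≥0) :
    ouPath lam (fun u => ouPath mu (fun r => ((min u r : ℝ≥0) : ℂ)) s) t = ouCov lam mu t s := by
  have h1 : ∀ u, ouPath mu (fun r => ((min u r : ℝ≥0) : ℂ)) s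
      = ∫ x in (0 : ℝ)..min s u, Complex.exp (mu * (s - x)) := by
    intro u
    have := ouPath_integral_min (g := fun _ => 1) continuous_const mu u s
    simp only [mul_one, intervalIntegral.integral_const, sub_zero, Complex.real_smul] at this
    rw [min_comm (s : ℝ) u, ← this]
    rfl
  simp_rw [h1]
  rw [ouPath_integral_min (by fun_prop), ouCov, min_comm]

end LinSDE

/-! ### Second moments of responses to Brownian motion. -/

namespace LinSDE

section Fubini

variable {Ω : Type*} [MeasurableSpace Ω] {μ : Measure Ω}

/-- A process with almost surely continuous paths is jointly measurable, up to null sets. -/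
theorem aestronglyMeasurable_path [SFinite μ] {f : ℝ≥0 → Ω → ℝ} (hm : ∀ t, AEMeasurable (f t) μ)
    (hc : ∀ᵐ ω ∂μ, Continuous fun t => f t ω) (ν : Measure ℝ) [SFinite ν] :
    AEStronglyMeasurable (fun z : ℝ × Ω => f z.1.toNNReal z.2) (ν.prod μ) := by
  -- Rounding time up to the grid of mesh `1 / n` uses countably many times only, so a single null
  -- set suffices; continuity of paths then gives convergence.
  have key : ∀ n : ℕ, AEStronglyMeasurable (fun z : ℝ × Ω =>
      f (((⌈z.1.toNNReal.toReal * n⌉₊ : ℝ) / n).toNNReal) z.2) (ν.prod μ) := by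
    intro n
    let g : ℕ × Ω → ℝ := fun q => (hm (((q.1 : ℝ) / n).toNNReal)).mk _ q.2
    have hg : Measurable g := measurable_from_prod_countable_right fun k =>
      (hm (((k : ℝ) / n).toNNReal)).measurable_mk
    have hcomp : Measurable fun z : ℝ × Ω => g (⌈z.1.toNNReal.toReal * n⌉₊, z.2) := by
      refine hg.comp (Measurable.prodMk ?_ measurable_snd)
      exact Nat.measurable_ceil.comp (by fun_prop)
    refine ⟨_, hcomp.stronglyMeasurable, ?_⟩
    have h1 : ∀ᵐ ω ∂μ, ∀ k : ℕ, f (((k : ℝ) / n).toNNReal) ω = g (k, ω) :=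
      ae_all_iff.2 fun k => (hm (((k : ℝ) / n).toNNReal)).ae_eq_mk
    filter_upwards [Measure.quasiMeasurePreserving_snd.ae h1] with z hz
    exact hz _
  refine aestronglyMeasurable_of_tendsto_ae atTop key ?_
  filter_upwards [Measure.quasiMeasurePreserving_snd.ae hc] with z hz
  refine (hz.tendsto z.1.toNNReal).comp ?_
  have h2 := (tendsto_nat_ceil_mul_div_atTop (R := ℝ) z.1.toNNReal.coe_nonneg).comp
    tendsto_natCast_atTop_atTop
  have h3 := (continuous_real_toNNReal.tendsto _).comp h2
  rw [Real.toNNReal_coe] at h3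
  exact h3

/-- Cauchy–Schwarz against the constant `1`. With `T` the total mass and `m` the integral, `∫ (T φ -
m)²` equals `T (T ∫ φ² - m²)` and is nonnegative; division by `T` leaves `T = 0` as a separate case.
-/
theorem sq_integral_le {ν : Measure ℝ} [IsFiniteMeasure ν] {φ : ℝ → ℝ} (h1 : Integrable φ ν)
    (h2 : Integrable (fun x => φ x ^ 2) ν) :
    (∫ x, φ x ∂ν) ^ 2 ≤ ν.real Set.univ * ∫ x, φ x ^ 2 ∂ν := by
  have h := integral_nonneg (μ := ν) (f := fun x => (ν.real Set.univ * φ x - ∫ x, φ x ∂ν) ^ 2)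
    fun x => sq_nonneg _
  set T := ν.real Set.univ
  set m := ∫ x, φ x ∂ν
  have he : ∀ x, (T * φ x - m) ^ 2 = T ^ 2 * φ x ^ 2 - 2 * T * m * φ x + m ^ 2 := fun x => by ring
  simp_rw [he] at h
  rw [integral_add (f := fun x => T ^ 2 * φ x ^ 2 - 2 * T * m * φ x)
      ((h2.const_mul _).sub (h1.const_mul _)) (integrable_const _),
    integral_sub (h2.const_mul _) (h1.const_mul _), integral_const_mul, integral_const_mul,
    integral_const] at h
  simp only [smul_eq_mul] at h
  change 0 ≤ T ^ 2 * ∫ x, φ x ^ 2 ∂ν - _ + T * m ^ 2 at h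
  have hT : 0 ≤ T := measureReal_nonneg
  rcases hT.eq_or_lt with h0 | h0
  · have : ν = 0 := by
      rw [← Measure.measure_univ_eq_zero]
      exact (measureReal_eq_zero_iff (measure_ne_top _ _)).1 h0.symm
    subst this
    simp [m]
  · have h3 : 0 ≤ T * (T * ∫ x, φ x ^ 2 ∂ν - m ^ 2) := by
      have : ∫ x, φ x ∂ν = m := rfl
      rw [this] at h
      linarith
    linarith [(mul_nonneg_iff_of_pos_left h0).1 h3]

variable {ν : Measure ℝ} [IsFiniteMeasure ν] [IsFiniteMeasure μ] {H : ℝ × Ω → ℂ}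

theorem memLp_integral_left (hH : MemLp H 2 (ν.prod μ)) :
    MemLp (fun ω => ∫ u, H (u, ω) ∂ν) 2 μ := by
  have hm : AEStronglyMeasurable (fun ω => ∫ u, H (u, ω) ∂ν) μ :=
    hH.1.prod_swap.integral_prod_right'
  have h1 : Integrable H (ν.prod μ) := hH.integrable (by norm_num)
  have h2 := (memLp_two_iff_integrable_sq_norm hH.1).1 hH
  rw [memLp_two_iff_integrable_sq_norm hm]
  refine (h2.integral_prod_right.const_mul (ν.real Set.univ)).mono' (hm.norm.pow 2) ?_
  filter_upwards [h1.prod_left_ae, h2.prod_left_ae] with ω hω1 hω2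
  rw [Real.norm_of_nonneg (by positivity)]
  calc ‖∫ u, H (u, ω) ∂ν‖ ^ 2 ≤ (∫ u, ‖H (u, ω)‖ ∂ν) ^ 2 := by
        gcongr
        exact norm_integral_le_integral_norm _
    _ ≤ _ := sq_integral_le hω1.norm hω2

theorem integral_integral_mul {Z : Ω → ℂ} (hH : MemLp H 2 (ν.prod μ)) (hZ : MemLp Z 2 μ) :
    ∫ ω, (∫ u, H (u, ω) ∂ν) * Z ω ∂μ = ∫ u, ∫ ω, H (u, ω) * Z ω ∂μ ∂ν := by
  have h : Integrable (fun z : ℝ × Ω => H z * Z z.2) (ν.prod μ) :=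
    hH.integrable_mul (hZ.comp_snd ν)
  rw [integral_integral_swap (f := fun u ω => H (u, ω) * Z ω) h]
  simp_rw [integral_mul_const]

end Fubini

section Brownian

variable {Ω : Type*} [MeasurableSpace Ω] {μ : Measure Ω}
  {B B' : ℝ≥0 → Ω → ℝ}

theorem memLp_two_brownian (hB : IsBrownianReal B μ) (t : ℝ≥0) : MemLp (B t) 2 μ :=
  (hB.isGaussianProcess.hasGaussianLaw_eval t).memLp_two

theorem memLp_two_brownian_ofReal (hB : IsBrownianReal B μ) (t : ℝ≥0) :
    MemLp (fun ω => (B t ω : ℂ)) 2 μ :=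
  (memLp_two_brownian hB t).ofReal (K := ℂ)

variable [IsProbabilityMeasure μ]

theorem integral_mul_brownian (hB : IsBrownianReal B μ) (t s : ℝ≥0) :
    ∫ ω, B t ω * B s ω ∂μ = min t s := by
  have h := covariance_eq_sub (memLp_two_brownian hB t) (memLp_two_brownian hB s)
  rw [hB.covariance_eval, hB.integral_eval, zero_mul, sub_zero] at h
  exact h.symm

/-- The second moment of `B_u` is `u`, integrable over `(0, t]`, and the exponential factor is
bounded there. This justifies all exchanges of expectation and time integral below. -/
theorem memLp_two_brownian_prod (hB : IsBrownianReal B μ) (lam : ℂ) (t : ℝ≥0) :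
    MemLp (fun z : ℝ × Ω => Complex.exp (lam * (t - z.1)) * (B z.1.toNNReal z.2 : ℂ)) 2
      ((volume.restrict (Set.Ioc (0 : ℝ) t)).prod μ) := by
  have hm := aestronglyMeasurable_path hB.aemeasurable hB.cont
    (volume.restrict (Set.Ioc (0 : ℝ) t))
  have h : MemLp (fun z : ℝ × Ω => B z.1.toNNReal z.2) 2
      ((volume.restrict (Set.Ioc (0 : ℝ) t)).prod μ) := by
    rw [memLp_two_iff_integrable_sq hm, integrable_prod_iff
      (f := fun z : ℝ × Ω => B z.1.toNNReal z.2 ^ 2) (hm.pow 2)]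
    refine ⟨Eventually.of_forall fun u =>
      (memLp_two_brownian hB u.toNNReal).integrable_sq, ?_⟩
    have he : ∀ u : ℝ, ∫ ω, ‖B u.toNNReal ω ^ 2‖ ∂μ = u.toNNReal := by
      intro u
      have := integral_mul_brownian hB u.toNNReal u.toNNReal
      rw [min_self] at this
      rw [← this]
      simp [← sq]
    simp_rw [he]
    exact ((by fun_prop : Continuous fun u : ℝ => (u.toNNReal : ℝ)).integrableOn_Icc).mono_set
      Set.Ioc_subset_Icc_self
  have hE : ContinuousOn (fun u : ℝ => ‖Complex.exp (lam * (t - u))‖) (Set.Icc 0 t) :=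
    Continuous.continuousOn (by fun_prop)
  obtain ⟨C, hC⟩ := isCompact_Icc.bddAbove_image hE
  have h' : MemLp (fun z : ℝ × Ω => (B z.1.toNNReal z.2 : ℂ)) 2
      ((volume.restrict (Set.Ioc (0 : ℝ) t)).prod μ) := h.ofReal (K := ℂ)
  refine MemLp.of_le_mul (c := C) h' ?_ ?_
  · exact Measurable.aestronglyMeasurable (by fun_prop) |>.mul h'.1
  · have h0 : ∀ᵐ u ∂(volume.restrict (Set.Ioc (0 : ℝ) t)), u ∈ Set.Ioc (0 : ℝ) t :=
      ae_restrict_mem measurableSet_Ioc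
    filter_upwards [Measure.quasiMeasurePreserving_fst.ae h0] with z hz
    rw [norm_mul]
    gcongr
    exact hC ⟨z.1, Set.Ioc_subset_Icc_self hz, rfl⟩

theorem memLp_ouPath (hB : IsBrownianReal B μ) (lam : ℂ) (t : ℝ≥0) :
    MemLp (fun ω => ouPath lam (fun u => (B u ω : ℂ)) t) 2 μ := by
  refine (memLp_two_brownian_ofReal hB t).add (MemLp.const_mul ?_ lam)
  simp_rw [intervalIntegral.integral_of_le t.coe_nonneg]
  exact memLp_integral_left (memLp_two_brownian_prod hB lam t)

/-- The response operator is linear, so by Fubini it commutes with pairing against a fixed square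
integrable `Z`. Used once in each factor, it reduces covariances of responses to those of the
Brownian motions. -/
theorem integral_ouPath_mul (hB : IsBrownianReal B μ) (lam : ℂ) (t : ℝ≥0) {Z : Ω → ℂ}
    (hZ : MemLp Z 2 μ) :
    ∫ ω, ouPath lam (fun u => (B u ω : ℂ)) t * Z ω ∂μ
      = ouPath lam (fun u => ∫ ω, (B u ω : ℂ) * Z ω ∂μ) t := by
  have hL := memLp_two_brownian_prod hB lam t
  simp only [ouPath, add_mul, intervalIntegral.integral_of_le t.coe_nonneg, mul_assoc lam]
  have h1 : Integrable (fun ω => (B t ω : ℂ) * Z ω) μ :=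
    (memLp_two_brownian_ofReal hB t).integrable_mul hZ
  have h2 : Integrable (fun ω => (∫ u in Set.Ioc (0 : ℝ) t,
      Complex.exp (lam * (t - u)) * (B u.toNNReal ω : ℂ)) * Z ω) μ :=
    (memLp_integral_left hL).integrable_mul hZ
  rw [integral_add h1 (h2.const_mul lam), integral_const_mul, integral_integral_mul hL hZ]
  simp_rw [mul_assoc, integral_const_mul]

theorem integral_ouPath (hB : IsBrownianReal B μ) (lam : ℂ) (t : ℝ≥0) :
    ∫ ω, ouPath lam (fun u => (B u ω : ℂ)) t ∂μ = 0 := by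
  have h := integral_ouPath_mul hB lam t (memLp_const (μ := μ) (p := 2) (1 : ℂ))
  simp only [mul_one] at h
  have h0 : ∀ u, ∫ ω, (B u ω : ℂ) ∂μ = 0 := fun u => by
    rw [integral_complex_ofReal, hB.integral_eval]
    simp
  rw [h]
  simp [ouPath, h0]

theorem integral_ouPath_mul_ouPath (hB : IsBrownianReal B μ) (lam mu : ℂ) (t s : ℝ≥0) :
    ∫ ω, ouPath lam (fun u => (B u ω : ℂ)) t * ouPath mu (fun u => (B u ω : ℂ)) s ∂μ
      = ouCov lam mu t s := by
  rw [integral_ouPath_mul hB lam t (memLp_ouPath hB mu s), ← ouPath_ouPath_min]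
  congr 1
  funext u
  simp_rw [mul_comm (B u _ : ℂ)]
  rw [integral_ouPath_mul hB mu s (memLp_two_brownian_ofReal hB u)]
  congr 1
  funext r
  rw [min_comm, ← integral_mul_brownian hB r u, ← integral_complex_ofReal]
  simp

theorem integral_ouPath_mul_ouPath_of_indepFun (hB : IsBrownianReal B μ)
    (hB' : IsBrownianReal B' μ) (h : IndepFun (fun ω t => B t ω) (fun ω t => B' t ω) μ)
    (lam mu : ℂ) (t s : ℝ≥0) :
    ∫ ω, ouPath lam (fun u => (B u ω : ℂ)) t * ouPath mu (fun u => (B' u ω : ℂ)) s ∂μ = 0 := by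
  rw [integral_ouPath_mul hB lam t (memLp_ouPath hB' mu s)]
  have h0 : ∀ u r, ∫ ω, (B' r ω : ℂ) * (B u ω : ℂ) ∂μ = 0 := by
    intro u r
    have hi : IndepFun (B' r) (B u) μ :=
      (h.comp (measurable_pi_apply u) (measurable_pi_apply r)).symm
    have := hi.integral_mul_eq_mul_integral (hB'.aemeasurable r).aestronglyMeasurable
      (hB.aemeasurable u).aestronglyMeasurable
    rw [hB.integral_eval, mul_zero] at this
    simp_rw [← Complex.ofReal_mul]
    rw [integral_complex_ofReal]
    exact_mod_cast this
  have h1 : ∀ u, ∫ ω, (B u ω : ℂ) * ouPath mu (fun r => (B' r ω : ℂ)) s ∂μ = 0 := by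
    intro u
    simp_rw [mul_comm (B u _ : ℂ)]
    rw [integral_ouPath_mul hB' mu s (memLp_two_brownian_ofReal hB u)]
    simp [ouPath, h0]
  simp only [h1]
  simp [ouPath]

end Brownian

end LinSDE

/-! ### Linear systems on a finite abelian group, solved by characters. -/

namespace LinSDE

section FiniteGroup

variable {G : Type*} [AddCommGroup G] [Fintype G]

/-- The eigenvalue, on the character `ψ`, of the convolution by `a` on a finite group. -/
noncomputable def eigenvalue (a : G → ℝ) (ψ : AddChar G ℂ) : ℂ := ∑ q, (a q : ℂ) * ψ (-q)

theorem eigenvalue_neg (a : G → ℝ) (ψ : AddChar G ℂ) :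
    eigenvalue a (-ψ) = starRingEnd ℂ (eigenvalue a ψ) := by
  simp [eigenvalue, AddChar.neg_apply, AddChar.map_neg_eq_conj]

theorem sum_char_mul_convolution (a : G → ℝ) (ψ : AddChar G ℂ) (x : G → ℂ) :
    ∑ p, ψ (-p) * ∑ p', (a (p - p') : ℂ) * x p' = eigenvalue a ψ * ∑ p, ψ (-p) * x p := by
  simp_rw [Finset.mul_sum]
  rw [Finset.sum_comm]
  refine Finset.sum_congr rfl fun p' _ => ?_
  rw [eigenvalue, Finset.sum_mul]
  refine Eq.trans ?_ (Equiv.sum_comp (Equiv.subRight p') _)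
  refine Finset.sum_congr rfl fun p _ => ?_
  have : ψ (-p) = ψ (-(p - p')) * ψ (-p') := by
    rw [← AddChar.map_add_eq_mul]
    congr 1
    abel
  rw [this, Equiv.subRight_apply]
  ring

/-- Fourier inversion, from the orthogonality relation for the sum over all characters. -/
theorem char_inversion (x : G → ℂ) (p : G) :
    x p = (Fintype.card G : ℂ)⁻¹ * ∑ ψ : AddChar G ℂ, ψ p * ∑ q, ψ (-q) * x q := by
  classical
  have hN : (Fintype.card G : ℂ) ≠ 0 := Nat.cast_ne_zero.2 Fintype.card_ne_zero
  have h : ∑ ψ : AddChar G ℂ, ψ p * ∑ q, ψ (-q) * x q = Fintype.card G * x p := by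
    simp_rw [Finset.mul_sum]
    rw [Finset.sum_comm]
    have : ∀ q, ∑ ψ : AddChar G ℂ, ψ p * (ψ (-q) * x q)
        = if q = p then (Fintype.card G : ℂ) * x p else 0 := by
      intro q
      simp_rw [← mul_assoc, ← AddChar.map_add_eq_mul]
      rw [← Finset.sum_mul, AddChar.sum_apply_eq_ite]
      by_cases h : q = p
      · simp [h]
      · rw [if_neg h, if_neg, zero_mul]
        rw [← sub_eq_add_neg, sub_eq_zero]
        exact fun h' => h h'.symm
    simp_rw [this]
    simp
  rw [h]
  field_simp

/-- A solution of the integral equation in terms of the driving paths. -/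
theorem eq_add_sum_ouPath (a : G → ℝ) (c : ℝ) (ξbar : G → ℝ) {ξ B : G → ℝ≥0 → ℝ}
    (hξ : ∀ p, Continuous (ξ p)) (hB : ∀ p, Continuous (B p))
    (h : ∀ p, ∀ t : ℝ≥0, ξ p t = ξbar p + c * B p t
      + ∫ u in (0 : ℝ)..t, ∑ p', a (p - p') * ξ p' u.toNNReal) (p : G) (t : ℝ≥0) :
    (ξ p t : ℂ) = (Fintype.card G : ℂ)⁻¹ * ∑ ψ : AddChar G ℂ, ψ p *
        (Complex.exp (eigenvalue a ψ * t) * ∑ q, ψ (-q) * ξbar q)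
      + ∑ ψ : AddChar G ℂ, ∑ q, (c * (Fintype.card G : ℂ)⁻¹ * ψ (p - q)) *
        ouPath (eigenvalue a ψ) (fun u => (B q u : ℂ)) t := by
  -- Each Fourier coefficient of `ξ` solves a scalar equation with rate `eigenvalue a ψ`, so
  -- variation of constants applies mode by mode.
  have hmode : ∀ ψ : AddChar G ℂ, ∑ q, ψ (-q) * (ξ q t : ℂ)
      = Complex.exp (eigenvalue a ψ * t) * ∑ q, ψ (-q) * ξbar q
        + ∑ q, (c * ψ (-q)) * ouPath (eigenvalue a ψ) (fun u => (B q u : ℂ)) t := by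
    intro ψ
    rw [← ouPath_sum Finset.univ _ (fun q => c * ψ (-q)) (fun q u => (B q u : ℂ))
      fun q => Complex.continuous_ofReal.comp (hB q)]
    refine eq_exp_add_ouPath (X := fun t => ∑ q, ψ (-q) * (ξ q t : ℂ))
      (by fun_prop) (by fun_prop) (fun t => ?_) t
    have h1 : ∀ q, (ξ q t : ℂ) = ξbar q + c * B q t
        + ∫ u in (0 : ℝ)..t, ∑ p', (a (q - p') : ℂ) * ξ p' u.toNNReal := by
      intro q
      rw [h q t]
      push_cast
      rw [← intervalIntegral.integral_ofReal]
      push_cast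
      rfl
    have h2 : ∑ q, ψ (-q) * ∫ u in (0 : ℝ)..t, ∑ p', (a (q - p') : ℂ) * ξ p' u.toNNReal
        = eigenvalue a ψ * ∫ u in (0 : ℝ)..t, ∑ q, ψ (-q) * (ξ q u.toNNReal : ℂ) := by
      simp_rw [← intervalIntegral.integral_const_mul]
      rw [← intervalIntegral.integral_finsetSum]
      · exact intervalIntegral.integral_congr fun u _ =>
          sum_char_mul_convolution a ψ fun p' => (ξ p' u.toNNReal : ℂ)
      · intro q _
        exact Continuous.intervalIntegrable (by fun_prop) _ _
    simp_rw [h1, mul_add, Finset.sum_add_distrib]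
    rw [h2]
    congr 2
    exact Finset.sum_congr rfl fun q _ => by ring
  rw [char_inversion (fun q => (ξ q t : ℂ)) p]
  simp_rw [hmode, mul_add, Finset.sum_add_distrib, mul_add]
  congr 1
  simp_rw [Finset.mul_sum]
  refine Finset.sum_congr rfl fun ψ _ => Finset.sum_congr rfl fun q _ => ?_
  rw [sub_eq_add_neg, AddChar.map_add_eq_mul]
  ring

variable {Ω : Type*} [MeasurableSpace Ω] {μ : Measure Ω} [IsProbabilityMeasure μ]

/-- The covariance between sites whose difference is `y`. -/
noncomputable def groupCov (a : G → ℝ) (v : ℝ) (y : G) (t s : ℝ≥0) : ℂ :=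
  v * ((Fintype.card G : ℂ)⁻¹ * ∑ ψ : AddChar G ℂ,
    ψ (-y) * ouCov (eigenvalue a ψ) (starRingEnd ℂ (eigenvalue a ψ)) t s)

/-- The fluctuating part of the solution. -/
noncomputable def noisePart (a : G → ℝ) (c : ℝ) (B : G → ℝ≥0 → Ω → ℝ) (p : G) (t : ℝ≥0) (ω : Ω) :
    ℂ :=
  ∑ ψ : AddChar G ℂ, ∑ q, (c * (Fintype.card G : ℂ)⁻¹ * ψ (p - q)) *
    ouPath (eigenvalue a ψ) (fun u => (B q u ω : ℂ)) t

variable {B : G → ℝ≥0 → Ω → ℝ}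

theorem memLp_noisePart (hB : ∀ p, IsBrownianReal (B p) μ) (a : G → ℝ) (c : ℝ) (p : G)
    (t : ℝ≥0) : MemLp (noisePart a c B p t) 2 μ :=
  memLp_finsetSum _ fun _ _ => memLp_finsetSum _ fun q _ => (memLp_ouPath (hB q) _ t).const_mul _

theorem integral_noisePart (hB : ∀ p, IsBrownianReal (B p) μ) (a : G → ℝ) (c : ℝ) (p : G)
    (t : ℝ≥0) : ∫ ω, noisePart a c B p t ω ∂μ = 0 := by
  have hi : ∀ (ψ : AddChar G ℂ) q, Integrable (fun ω =>
      (c * (Fintype.card G : ℂ)⁻¹ * ψ (p - q)) *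
        ouPath (eigenvalue a ψ) (fun u => (B q u ω : ℂ)) t) μ := fun ψ q =>
    ((memLp_ouPath (hB q) _ t).const_mul _).integrable (by norm_num)
  unfold noisePart
  rw [integral_finsetSum _ fun ψ _ => integrable_finsetSum _ fun q _ => hi ψ q]
  refine Finset.sum_eq_zero fun ψ _ => ?_
  rw [integral_finsetSum _ fun q _ => hi ψ q]
  refine Finset.sum_eq_zero fun q _ => ?_
  rw [integral_const_mul, integral_ouPath (hB q), mul_zero]

/-- Independence kills the terms with two different Brownian motions. What remains is a sum over `q`
of the character `ψ + ψ'`, nonzero only for `ψ' = -ψ`; this pairs each eigenvalue with its conjugate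
and removes `p`. -/
theorem integral_noisePart_mul (hB : ∀ p, IsBrownianReal (B p) μ)
    (hind : iIndepFun (fun p ω t => B p t ω) μ) (a : G → ℝ) {v : ℝ} (hv : 0 ≤ v) (p y : G)
    (t s : ℝ≥0) :
    ∫ ω, noisePart a (√v) B p t ω * noisePart a (√v) B (p + y) s ω ∂μ = groupCov a v y t s := by
  classical
  set N : ℂ := (Fintype.card G : ℂ) with hNdef
  have hN : N ≠ 0 := Nat.cast_ne_zero.2 Fintype.card_ne_zero
  have hc : ((√v : ℝ) : ℂ) * ((√v : ℝ) : ℂ) = v := by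
    rw [← Complex.ofReal_mul, Real.mul_self_sqrt hv]
  set k : AddChar G ℂ → G → G → ℂ := fun ψ p q => ((√v : ℝ) : ℂ) * N⁻¹ * ψ (p - q) with hk
  set Y : AddChar G ℂ → G → ℝ≥0 → Ω → ℂ := fun ψ q t ω =>
    ouPath (eigenvalue a ψ) (fun u => (B q u ω : ℂ)) t with hY
  have hi : ∀ ψ q ψ' q', Integrable (fun ω => k ψ p q * Y ψ q t ω
      * (k ψ' (p + y) q' * Y ψ' q' s ω)) μ := fun ψ q ψ' q' =>
    ((memLp_ouPath (hB q) _ t).const_mul _).integrable_mul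
      ((memLp_ouPath (hB q') _ s).const_mul _)
  have hexp : ∀ ω, noisePart a (√v) B p t ω * noisePart a (√v) B (p + y) s ω
      = ∑ ψ, ∑ ψ', ∑ q, ∑ q', k ψ p q * Y ψ q t ω * (k ψ' (p + y) q' * Y ψ' q' s ω) := by
    intro ω
    simp only [noisePart, Finset.sum_mul_sum]
    rfl
  simp_rw [hexp]
  rw [integral_finsetSum _ fun ψ _ => integrable_finsetSum _ fun ψ' _ =>
    integrable_finsetSum _ fun q _ => integrable_finsetSum _ fun q' _ => hi ψ q ψ' q']
  have hpair : ∀ ψ q ψ' q', ∫ ω, k ψ p q * Y ψ q t ω * (k ψ' (p + y) q' * Y ψ' q' s ω) ∂μ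
      = if q' = q then k ψ p q * k ψ' (p + y) q * ouCov (eigenvalue a ψ) (eigenvalue a ψ') t s
        else 0 := by
    intro ψ q ψ' q'
    have : ∀ ω, k ψ p q * Y ψ q t ω * (k ψ' (p + y) q' * Y ψ' q' s ω)
        = k ψ p q * k ψ' (p + y) q' * (Y ψ q t ω * Y ψ' q' s ω) := fun ω => by ring
    simp_rw [this]
    rw [integral_const_mul]
    split_ifs with h
    · subst h
      rw [integral_ouPath_mul_ouPath (hB q')]
    · rw [integral_ouPath_mul_ouPath_of_indepFun (hB q) (hB q')
        (hind.indepFun (Ne.symm h)), mul_zero]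
  have hinner : ∀ ψ ψ' : AddChar G ℂ, ∑ q, k ψ p q * k ψ' (p + y) q
      = if ψ' = -ψ then (v : ℂ) * N⁻¹ * ψ (-y) else 0 := by
    intro ψ ψ'
    have h1 : ∀ q, k ψ p q * k ψ' (p + y) q
        = (v : ℂ) * N⁻¹ * N⁻¹ * (ψ p * ψ' (p + y)) * (ψ + ψ') (-q) := by
      intro q
      simp only [hk, sub_eq_add_neg, AddChar.map_add_eq_mul, AddChar.add_apply]
      linear_combination N⁻¹ * N⁻¹ * ψ p * ψ (-q) * ψ' p * ψ' y * ψ' (-q) * hc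
    simp_rw [h1]
    have h2 : ∑ q, (ψ + ψ') (-q) = ∑ q, (ψ + ψ') q := Equiv.sum_comp (Equiv.neg G) _
    rw [← Finset.mul_sum, h2, AddChar.sum_eq_ite]
    by_cases h : ψ' = -ψ
    · subst h
      rw [if_pos (by simp), if_pos rfl]
      have h2 : ψ p * (-ψ) (p + y) = ψ (-y) := by
        rw [AddChar.neg_apply, ← AddChar.map_add_eq_mul]
        congr 1
        abel
      rw [h2]
      change _ * N = _
      field_simp
    · rw [if_neg h, if_neg, mul_zero]
      exact fun h' => h (eq_neg_of_add_eq_zero_right h')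
  rw [groupCov, Finset.mul_sum, Finset.mul_sum]
  refine Finset.sum_congr rfl fun ψ _ => ?_
  rw [integral_finsetSum _ fun ψ' _ => integrable_finsetSum _ fun q _ =>
    integrable_finsetSum _ fun q' _ => hi ψ q ψ' q']
  have h3 : ∀ ψ' : AddChar G ℂ, ∫ ω, ∑ q, ∑ q', k ψ p q * Y ψ q t ω
      * (k ψ' (p + y) q' * Y ψ' q' s ω) ∂μ = if ψ' = -ψ then (v : ℂ) * N⁻¹ * ψ (-y)
        * ouCov (eigenvalue a ψ) (eigenvalue a ψ') t s else 0 := by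
    intro ψ'
    rw [integral_finsetSum _ fun q _ => integrable_finsetSum _ fun q' _ => hi ψ q ψ' q']
    simp_rw [integral_finsetSum _ fun q' _ => hi ψ _ ψ' q', hpair]
    simp only [Finset.sum_ite_eq', Finset.mem_univ, if_true]
    rw [← Finset.sum_mul, hinner]
    split_ifs <;> simp
  simp_rw [h3]
  simp only [Finset.sum_ite_eq', Finset.mem_univ, if_true, eigenvalue_neg]
  ring

/-- Almost surely `ξ` is a deterministic `d`, depending on the initial data, plus a centred noise;
`d` is the mean and cancels from the covariance. -/
theorem memLp_and_cov_eq_groupCov (a : G → ℝ) {v : ℝ} (hv : 0 ≤ v) (ξbar : G → ℝ)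
    {ξ : G → ℝ≥0 → Ω → ℝ}
    (hξ : ∀ᵐ ω ∂μ, ∀ p, Continuous fun t => ξ p t ω)
    (hB : ∀ p, IsBrownianReal (B p) μ) (hind : iIndepFun (fun p ω t => B p t ω) μ)
    (heq : ∀ᵐ ω ∂μ, ∀ p, ∀ t : ℝ≥0, ξ p t ω = ξbar p + √v * B p t ω
        + ∫ u in (0 : ℝ)..t, ∑ p', a (p - p') * ξ p' u.toNNReal ω) :
    (∀ p t, MemLp (ξ p t) 2 μ) ∧ ∀ p y t s,
      ((covW μ ξ p (p + y) t s : ℝ) : ℂ) = groupCov a v y t s := by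
  set d : G → ℝ≥0 → ℂ := fun p t => (Fintype.card G : ℂ)⁻¹ * ∑ ψ : AddChar G ℂ, ψ p *
        (Complex.exp (eigenvalue a ψ * t) * ∑ q, ψ (-q) * ξbar q) with hd
  have hBc : ∀ᵐ ω ∂μ, ∀ p, Continuous fun t => B p t ω := ae_all_iff.2 fun p => (hB p).cont
  have hrep : ∀ᵐ ω ∂μ, ∀ p t, (ξ p t ω : ℂ) = d p t + noisePart a (√v) B p t ω := by
    filter_upwards [hξ, hBc, heq] with ω h1 h2 h3 p t
    exact eq_add_sum_ouPath a (√v) ξbar (ξ := fun p t => ξ p t ω) (B := fun p t => B p t ω)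
      h1 h2 h3 p t
  have hY := memLp_noisePart hB a (√v)
  have hYi : ∀ p t, Integrable (noisePart a (√v) B p t) μ := fun p t =>
    (hY p t).integrable (by norm_num)
  refine ⟨fun p t => ?_, fun p y t s => ?_⟩
  · have h := ((memLp_const (d p t)).add (hY p t)).re
    refine h.ae_eq ?_
    filter_upwards [hrep] with ω hω
    simp [← hω p t]
  · have hmean : ∀ p t, ((meanM μ ξ p t : ℝ) : ℂ) = d p t := by
      intro p t
      rw [meanM, ← integral_complex_ofReal, integral_congr_ae (hrep.mono fun ω hω => hω p t),
        integral_add (integrable_const _) (hYi p t), integral_noisePart hB]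
      simp
    rw [covW, corrC]
    push_cast
    rw [hmean, hmean, ← integral_complex_ofReal, ← integral_noisePart_mul hB hind a hv p y t s]
    have h1 : ∫ ω, ((ξ p t ω * ξ (p + y) s ω : ℝ) : ℂ) ∂μ
        = ∫ ω, (d p t * d (p + y) s + (d p t * noisePart a (√v) B (p + y) s ω
          + (d (p + y) s * noisePart a (√v) B p t ω
          + noisePart a (√v) B p t ω * noisePart a (√v) B (p + y) s ω))) ∂μ := by
      refine integral_congr_ae ?_
      filter_upwards [hrep] with ω hω
      push_cast
      rw [hω, hω]
      ring
    have hYY : Integrable (fun ω => noisePart a (√v) B p t ω * noisePart a (√v) B (p + y) s ω) μ :=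
      (hY p t).integrable_mul (hY (p + y) s)
    have h0 : ∀ (z : ℂ) p t, ∫ ω, z * noisePart a (√v) B p t ω ∂μ = 0 := fun z p t => by
      rw [integral_const_mul, integral_noisePart hB, mul_zero]
    have hY2 : Integrable (fun ω => d (p + y) s * noisePart a (√v) B p t ω
        + noisePart a (√v) B p t ω * noisePart a (√v) B (p + y) s ω) μ :=
      ((hYi p t).const_mul _).add hYY
    have hY3 : Integrable (fun ω => d p t * noisePart a (√v) B (p + y) s ω
        + (d (p + y) s * noisePart a (√v) B p t ω
        + noisePart a (√v) B p t ω * noisePart a (√v) B (p + y) s ω)) μ :=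
      ((hYi (p + y) s).const_mul _).add hY2
    rw [h1, integral_add (integrable_const _) hY3, integral_add ((hYi _ _).const_mul _) hY2,
      integral_add ((hYi _ _).const_mul _) hYY, h0, h0]
    simp

end FiniteGroup

end LinSDE

/-! ### The twisted torus and its infinite volume limit. -/

namespace LinSDE

section FiniteSystem

/-- The symbol `Â` as a function on the unit torus. -/
noncomputable def symbolTorus (A : Site → Site → ℝ) (x : UnitAddTorus (Fin 2)) : ℂ :=
  ∑' r : Site, (A r 0 : ℂ) * UnitAddTorus.mFourier (-r) x

theorem continuous_symbolTorus {A : Site → Site → ℝ} (hA : Summable fun p => A p 0) :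
    Continuous (symbolTorus A) := by
  refine continuous_tsum (u := fun r => |A r 0|) (fun r => by fun_prop) hA.abs fun r x => ?_
  rw [norm_mul, Complex.norm_real, Real.norm_eq_abs]
  refine mul_le_of_le_one_right (abs_nonneg _) ?_
  exact (ContinuousMap.norm_coe_le_norm _ _).trans UnitAddTorus.mFourier_norm.le

/-- The point of the unit torus at which a character of the twisted torus evaluates the
monomials. -/
theorem exists_point (m m₂ : ℕ) [Finite (Torus m m₂)] (ψ : AddChar (Torus m m₂) ℂ) :
    ∃ x : UnitAddTorus (Fin 2), ∀ n : Site, UnitAddTorus.mFourier n x = ψ (QuotientAddGroup.mk n) := by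
  -- A character of a finite group has modulus one, so its value on each basis vector is a point of
  -- the circle; multiplicativity fixes the rest.
  have hx : ∀ i : Fin 2, ∃ x : UnitAddCircle, ((AddCircle.toCircle x : Circle) : ℂ)
      = ψ (QuotientAddGroup.mk (Pi.single i 1)) := by
    intro i
    obtain ⟨x, hx⟩ := (AddCircle.homeomorphCircle (T := 1) one_ne_zero).surjective
      ⟨ψ (QuotientAddGroup.mk (Pi.single i 1)), mem_sphere_zero_iff_norm.2 (ψ.norm_apply _)⟩
    refine ⟨x, ?_⟩
    rw [← AddCircle.homeomorphCircle_apply one_ne_zero, hx]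
  choose x hx using hx
  refine ⟨x, fun n => ?_⟩
  have hn : (QuotientAddGroup.mk n : Torus m m₂) = ∑ i, n i • QuotientAddGroup.mk (Pi.single i 1) := by
    conv_lhs => rw [← Finset.univ_sum_single n]
    simp only [Fin.sum_univ_two]
    rw [QuotientAddGroup.mk_add]
    congr 1 <;> rw [← QuotientAddGroup.mk_zsmul, ← Pi.single_smul] <;> simp
  rw [hn]
  simp only [UnitAddTorus.mFourier, ContinuousMap.coe_mk, fourier_apply, Fin.sum_univ_two,
    Fin.prod_univ_two, AddChar.map_add_eq_mul, AddCircle.toCircle_zsmul, Circle.coe_zpow, hx]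
  congr 1 <;> exact (AddChar.map_zsmul_eq_zpow _ _ _).symm

/-- The average of a function on the unit torus over the characters of the twisted torus. -/
noncomputable def charAverage (m m₂ : ℕ) (F : UnitAddTorus (Fin 2) → ℂ) : ℂ :=
  if h : 0 < m then
    haveI := finite_torus h m₂
    letI := Fintype.ofFinite (Torus m m₂)
    (Fintype.card (Torus m m₂) : ℂ)⁻¹ *
      ∑ ψ : AddChar (Torus m m₂) ℂ, F (exists_point m m₂ ψ).choose
  else 0

theorem charAverage_add (m m₂ : ℕ) (F F' : UnitAddTorus (Fin 2) → ℂ) :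
    charAverage m m₂ (fun x => F x + F' x) = charAverage m m₂ F + charAverage m m₂ F' := by
  unfold charAverage
  split_ifs
  · rw [Finset.sum_add_distrib, mul_add]
  · simp

theorem charAverage_const_mul (m m₂ : ℕ) (c : ℂ) (F : UnitAddTorus (Fin 2) → ℂ) :
    charAverage m m₂ (fun x => c * F x) = c * charAverage m m₂ F := by
  unfold charAverage
  split_ifs
  · rw [← Finset.mul_sum, mul_left_comm]
  · simp

theorem norm_charAverage_le (m m₂ : ℕ) {F : UnitAddTorus (Fin 2) → ℂ} {C : ℝ} (hC0 : 0 ≤ C)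
    (hC : ∀ x, ‖F x‖ ≤ C) : ‖charAverage m m₂ F‖ ≤ C := by
  unfold charAverage
  split_ifs with h
  · have := finite_torus h m₂
    let _ := Fintype.ofFinite (Torus m m₂)
    have hN : (0 : ℝ) < Fintype.card (Torus m m₂) := Nat.cast_pos.2 Fintype.card_pos
    rw [norm_mul, norm_inv, Complex.norm_natCast, inv_mul_le_iff₀ hN]
    refine (norm_sum_le_of_le _ fun ψ _ => hC _).trans ?_
    rw [Finset.sum_const, Finset.card_univ, AddChar.card_eq, nsmul_eq_mul]
  · simpa using hC0

/-- Averaging over all characters detects whether `n` is a period. In `(j₁ m - j₂ m₂, j₂ m)` a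
second coordinate below `m` forces `j₂ = 0`, and then the first forces `j₁ = 0`; hence `m₂` plays no
role. -/
theorem charAverage_mFourier {m m₂ : ℕ} (n : Site) (hm : ∀ i, |n i| < m) :
    charAverage m m₂ (UnitAddTorus.mFourier n) = if n = 0 then 1 else 0 := by
  classical
  have h : 0 < m := by
    have := (abs_nonneg _).trans_lt (hm 0)
    exact_mod_cast this
  have := finite_torus h m₂
  let _ := Fintype.ofFinite (Torus m m₂)
  have hN : (Fintype.card (Torus m m₂) : ℂ) ≠ 0 := Nat.cast_ne_zero.2 Fintype.card_ne_zero
  rw [charAverage, dif_pos h]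
  simp_rw [fun ψ : AddChar (Torus m m₂) ℂ => (exists_point m m₂ ψ).choose_spec n]
  rw [AddChar.sum_apply_eq_ite]
  have hiff : (QuotientAddGroup.mk n : Torus m m₂) = 0 ↔ n = 0 := by
    rw [QuotientAddGroup.eq_zero_iff]
    refine ⟨?_, fun h => h ▸ zero_mem _⟩
    rintro ⟨j₁, j₂, rfl⟩
    have hz : ∀ j : ℤ, |j * (m : ℤ)| < m → j = 0 := by
      intro j hj
      by_contra hj0
      have h1 : 1 ≤ |j| := Int.one_le_abs hj0
      rw [abs_mul, Nat.abs_cast] at hj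
      nlinarith
    have h2 : j₂ = 0 := hz j₂ (by simpa using hm 1)
    subst h2
    have h1 : j₁ = 0 := hz j₁ (by simpa using hm 0)
    subst h1
    ext i
    fin_cases i <;> simp
  simp only [hiff]
  split_ifs
  · field_simp
  · simp

/-- A fundamental domain of `ℤ²` in `ℝ²`. -/
def unitCube : Set (Fin 2 → ℝ) := {x | ∀ i, x i ∈ Set.Ioc ((fun _ => -1 / 2 : Fin 2 → ℝ) i)
  ((fun _ => -1 / 2 : Fin 2 → ℝ) i + 1)}

theorem volume_unitCube : volume unitCube = 1 := by
  have : unitCube = Set.pi Set.univ fun _ => Set.Ioc (-1 / 2) (-1 / 2 + 1) := by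
    ext x
    simp [unitCube]
  rw [this, Real.volume_pi_Ioc]
  norm_num

instance : IsProbabilityMeasure (volume.restrict unitCube) :=
  ⟨by rw [Measure.restrict_apply_univ, volume_unitCube]⟩

/-- The mean of a function on the unit torus. -/
noncomputable def torusMean (F : UnitAddTorus (Fin 2) → ℂ) : ℂ :=
  ∫ x in unitCube, F (fun i => (x i : UnitAddCircle))

theorem integrable_torus (F : C(UnitAddTorus (Fin 2), ℂ)) :
    Integrable (fun x : Fin 2 → ℝ => F (fun i => (x i : UnitAddCircle)))
      (volume.restrict unitCube) := by
  have hc : Continuous fun x : Fin 2 → ℝ => F (fun i => (x i : UnitAddCircle)) :=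
    F.continuous.comp (continuous_pi fun i =>
      (AddCircle.continuous_mk' (1 : ℝ)).comp (continuous_apply i))
  exact Integrable.of_bound hc.aestronglyMeasurable ‖F‖
    (Eventually.of_forall fun x => F.norm_coe_le_norm _)

/-- The mean is the zeroth Fourier coefficient, so this is orthonormality of the monomials. -/
theorem torusMean_mFourier (n : Site) :
    torusMean (UnitAddTorus.mFourier n) = if n = 0 then (1 : ℂ) else 0 := by
  have h := orthonormal_iff_ite.1 (UnitAddTorus.orthonormal_mFourier (d := Fin 2)) 0 n
  have h2 := UnitAddTorus.mFourierCoeff_toLp (d := Fin 2) (UnitAddTorus.mFourier n) 0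
  rw [← UnitAddTorus.mFourierBasis_repr, HilbertBasis.repr_apply_apply,
    UnitAddTorus.coe_mFourierBasis,
    UnitAddTorus.mFourierCoeff_eq_integral _ _ (fun _ => -1 / 2 : Fin 2 → ℝ)] at h2
  simp only [neg_zero, UnitAddTorus.mFourier_zero, ContinuousMap.one_apply, one_smul] at h2
  refine h2.symm.trans (h.trans ?_)
  simp only [eq_comm]

/-- The points of the unit torus given by the characters are equidistributed as `m → ∞`. -/
theorem tendsto_charAverage (m₂ : ℕ → ℕ) (F : C(UnitAddTorus (Fin 2), ℂ)) :
    Tendsto (fun m => charAverage m (m₂ m) F) atTop (𝓝 (torusMean F)) := by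
  -- For a trigonometric polynomial the average equals the mean as soon as `m` exceeds its degrees.
  -- Both functionals are contractions in the sup norm, so density of these polynomials gives the
  -- general case.
  have hspan : ∀ P ∈ Submodule.span ℂ (Set.range (UnitAddTorus.mFourier (d := Fin 2))),
      Tendsto (fun m => charAverage m (m₂ m) P) atTop (𝓝 (torusMean P)) := by
    intro P hP
    induction hP using Submodule.span_induction with
    | mem P hP =>
      obtain ⟨n, rfl⟩ := hP
      refine tendsto_const_nhds.congr' ?_
      have h1 : ∀ᶠ m : ℕ in atTop, ∀ i, |n i| < m := by
        rw [eventually_all]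
        intro i
        filter_upwards [eventually_gt_atTop (n i).natAbs] with m hm
        rw [Int.abs_eq_natAbs]
        exact_mod_cast hm
      filter_upwards [h1] with m hm
      rw [charAverage_mFourier n hm, torusMean_mFourier]
    | zero =>
      have : ∀ m, charAverage m (m₂ m) (0 : C(UnitAddTorus (Fin 2), ℂ)) = 0 := fun m =>
        norm_le_zero_iff.1 (norm_charAverage_le _ _ le_rfl (by simp))
      have h0 : torusMean (0 : C(UnitAddTorus (Fin 2), ℂ)) = 0 := by simp [torusMean]
      rw [h0]
      exact tendsto_const_nhds.congr fun m => (this m).symm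
    | add P Q _ _ hP hQ =>
      have := hP.add hQ
      simp_rw [← charAverage_add] at this
      rw [torusMean, torusMean, ← integral_add (integrable_torus P) (integrable_torus Q)] at this
      exact this
    | smul c P _ hP =>
      have := hP.const_mul c
      simp_rw [← charAverage_const_mul] at this
      rw [torusMean, ← integral_const_mul] at this
      exact this
  rw [Metric.tendsto_atTop]
  intro ε hε
  have hF : F ∈ closure (Submodule.span ℂ (Set.range (UnitAddTorus.mFourier (d := Fin 2))) :
      Set C(UnitAddTorus (Fin 2), ℂ)) := by
    rw [← Submodule.topologicalClosure_coe, UnitAddTorus.span_mFourier_closure_eq_top]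
    trivial
  obtain ⟨P, hP, hFP⟩ := Metric.mem_closure_iff.1 hF (ε / 3) (by positivity)
  obtain ⟨N, hN⟩ := Metric.tendsto_atTop.1 (hspan P hP) (ε / 3) (by positivity)
  refine ⟨N, fun m hm => ?_⟩
  rw [dist_eq_norm] at hFP
  have hpt : ∀ x, ‖F x - P x‖ ≤ ε / 3 := fun x =>
    ((F - P).norm_coe_le_norm x).trans hFP.le
  have h1 : ‖charAverage m (m₂ m) F - charAverage m (m₂ m) P‖ ≤ ε / 3 := by
    have h := norm_charAverage_le m (m₂ m) (by positivity) hpt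
    have he : charAverage m (m₂ m) (fun x => F x - P x)
        = charAverage m (m₂ m) F - charAverage m (m₂ m) P := by
      have := charAverage_add m (m₂ m) (fun x => F x - P x) P
      simp only [sub_add_cancel] at this
      rw [eq_sub_iff_add_eq, ← this]
    rwa [he] at h
  have h2 : ‖torusMean F - torusMean P‖ ≤ ε / 3 := by
    rw [torusMean, torusMean, ← integral_sub (integrable_torus F) (integrable_torus P)]
    refine (norm_integral_le_of_norm_le_const (C := ε / 3)
      (Eventually.of_forall fun x => hpt _)).trans ?_
    simp
  have h3 := hN m hm
  rw [dist_eq_norm] at h3 ⊢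
  have he : charAverage m (m₂ m) F - torusMean F
      = (charAverage m (m₂ m) F - charAverage m (m₂ m) P)
        + (charAverage m (m₂ m) P - torusMean P) - (torusMean F - torusMean P) := by ring
  rw [he]
  refine (norm_sub_le _ _).trans_lt ?_
  refine (add_le_add_left (norm_add_le _ _) _).trans_lt ?_
  linarith

/-- The Fourier transform of the covariance in infinite volume, divided by `v`. -/
noncomputable def covDensity (A : Site → Site → ℝ) (y : Site) (t s : ℝ≥0)
    (x : UnitAddTorus (Fin 2)) : ℂ :=
  UnitAddTorus.mFourier (-y) x *
    ouCov (symbolTorus A x) (starRingEnd ℂ (symbolTorus A x)) t s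

theorem continuous_covDensity {A : Site → Site → ℝ} (hA : Summable fun p => A p 0) (y : Site)
    (t s : ℝ≥0) : Continuous (covDensity A y t s) := by
  have := continuous_symbolTorus hA
  refine (ContinuousMap.continuous _).mul ?_
  unfold ouCov
  refine intervalIntegral.continuous_parametric_intervalIntegral_of_continuous' ?_ _ _
  fun_prop

/-- The symbol series converges absolutely and may be grouped by classes modulo the periods; at the
point of a character its monomials depend on the class only. -/
theorem eigenvalue_torus {A : Site → Site → ℝ} (hA : Summable fun p => A p 0) {m m₂ : ℕ}
    [Fintype (Torus m m₂)] (ψ : AddChar (Torus m m₂) ℂ) {x : UnitAddTorus (Fin 2)}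
    (hx : ∀ n : Site, UnitAddTorus.mFourier n x = ψ (QuotientAddGroup.mk n)) :
    eigenvalue (fun q => torusMatrix A m m₂ q 0) ψ = symbolTorus A x := by
  have hs : Summable fun r : Site => (A r 0 : ℂ) * UnitAddTorus.mFourier (-r) x := by
    refine Summable.of_norm_bounded hA.abs fun r => ?_
    rw [norm_mul, Complex.norm_real, Real.norm_eq_abs]
    refine mul_le_of_le_one_right (abs_nonneg _) ?_
    exact (ContinuousMap.norm_coe_le_norm _ _).trans UnitAddTorus.mFourier_norm.le
  let e := Equiv.sigmaFiberEquiv (QuotientAddGroup.mk : Site → Torus m m₂)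
  rw [symbolTorus, ← e.tsum_eq, Summable.tsum_sigma (f := fun c => (A (e c) 0 : ℂ) *
    UnitAddTorus.mFourier (-(e c)) x) (e.summable_iff.2 hs), tsum_fintype, eigenvalue]
  refine Finset.sum_congr rfl fun q _ => ?_
  have h1 : ∀ r : {r : Site // (QuotientAddGroup.mk r : Torus m m₂) = q},
      (A (e ⟨q, r⟩) 0 : ℂ) * UnitAddTorus.mFourier (-(e ⟨q, r⟩)) x = (A r 0 : ℂ) * ψ (-q) := by
    rintro ⟨r, rfl⟩
    rw [hx]
    rfl
  simp_rw [h1]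
  rw [tsum_mul_right, torusMatrix, Complex.ofReal_tsum, sub_zero]

/-- The covariance in the finite system. -/
noncomputable def finiteCov (A : Site → Site → ℝ) (v : ℝ) (m m₂ : ℕ) (y : Site) (t s : ℝ≥0) : ℝ :=
  (v * charAverage m m₂ (covDensity A y t s)).re

/-- The covariance in infinite volume. -/
noncomputable def limitCov (A : Site → Site → ℝ) (v : ℝ) (y : Site) (t s : ℝ≥0) : ℝ :=
  (v * torusMean (covDensity A y t s)).re

theorem tendsto_finiteCov {A : Site → Site → ℝ} (hA : Summable fun p => A p 0) (v : ℝ)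
    (m₂ : ℕ → ℕ) (y : Site) (t s : ℝ≥0) :
    Tendsto (fun m => finiteCov A v m (m₂ m) y t s) atTop (𝓝 (limitCov A v y t s)) :=
  (Complex.continuous_re.tendsto _).comp
    ((tendsto_charAverage m₂ ⟨_, continuous_covDensity hA y t s⟩).const_mul (v : ℂ))

theorem memLp_and_covW_eq_finiteCov {A : Site → Site → ℝ} (hA : Summable fun p => A p 0) {v : ℝ}
    (hv : 0 ≤ v) {m m₂ : ℕ} (hm : 0 < m) {Ω : Type*} [MeasurableSpace Ω] {μ : Measure Ω}
    [IsProbabilityMeasure μ] {ξbar : Torus m m₂ → ℝ} {ξ : Torus m m₂ → ℝ≥0 → Ω → ℝ}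
    (h : IsSolution μ A v m m₂ ξbar ξ) :
    (∀ p t, MemLp (ξ p t) 2 μ) ∧ ∀ (p : Torus m m₂) (y : Site) (t s : ℝ≥0),
      covW μ ξ p (p + (QuotientAddGroup.mk y : Torus m m₂)) t s = finiteCov A v m m₂ y t s := by
  have := finite_torus hm m₂
  let _ := Fintype.ofFinite (Torus m m₂)
  obtain ⟨B, hB, hind, heq⟩ := h.equation
  have heq' : ∀ᵐ ω ∂μ, ∀ p, ∀ t : ℝ≥0, ξ p t ω = ξbar p + √v * B p t ω
      + ∫ u in (0 : ℝ)..t, ∑ p', (fun q => torusMatrix A m m₂ q 0) (p - p')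
        * ξ p' u.toNNReal ω := by
    filter_upwards [heq] with ω hω p t
    have hz : ∀ p p', torusMatrix A m m₂ p p' = torusMatrix A m m₂ (p - p') 0 := fun p p' => by
      rw [torusMatrix, torusMatrix, sub_zero]
    rw [hω p t]
    simp only [finsum_eq_sum_of_fintype, ← hz]
  obtain ⟨h1, h2⟩ := memLp_and_cov_eq_groupCov (fun q => torusMatrix A m m₂ q 0) hv ξbar
    h.continuous hB hind heq'
  refine ⟨h1, fun p y t s => ?_⟩
  rw [finiteCov, ← Complex.ofReal_re (covW _ _ _ _ _ _), h2, groupCov, charAverage, dif_pos hm]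
  congr 3
  refine Finset.sum_congr rfl fun ψ _ => ?_
  have hx := (exists_point m m₂ ψ).choose_spec
  rw [covDensity, eigenvalue_torus hA ψ hx, hx, QuotientAddGroup.mk_neg]

end FiniteSystem

end LinSDE

/-! ### Behaviour of the symbol near the origin and on the zone. -/

namespace LinSDE

section Taylor

variable {E F : Type*} [NormedAddCommGroup E] [NormedSpace ℝ E] [NormedAddCommGroup F]
  [NormedSpace ℝ F]

theorem eq_zero_of_eq_neg {x : E} (h : x = -x) : x = 0 := by
  have h2 : (2 : ℝ) • x = 0 := by
    rw [two_smul]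
    nth_rewrite 2 [h]
    exact add_neg_cancel x
  exact (smul_eq_zero.1 h2).resolve_left two_ne_zero

/-- Mean value inequality on the closed ball of radius `‖x‖`, where the derivative is at most `C ‖x‖
^ n`. -/
theorem isBigO_pow_succ_of_fderiv {f : E → F} (hf : Differentiable ℝ f) (h0 : f 0 = 0) {n : ℕ}
    (h : fderiv ℝ f =O[𝓝 0] fun x => ‖x‖ ^ n) : f =O[𝓝 0] fun x => ‖x‖ ^ (n + 1) := by
  obtain ⟨C, hC⟩ := h.bound
  obtain ⟨δ, hδ, hball⟩ := Metric.eventually_nhds_iff_ball.1 hC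
  refine IsBigO.of_bound C ?_
  filter_upwards [Metric.ball_mem_nhds (0 : E) hδ] with x hx
  have hx' : ‖x‖ < δ := by simpa using hx
  have hb : ∀ z ∈ Metric.closedBall (0 : E) ‖x‖, ‖fderiv ℝ f z‖ ≤ C * ‖x‖ ^ n := by
    intro z hz
    have hz' : ‖z‖ ≤ ‖x‖ := by simpa using hz
    have h1 := hball z (by simpa using hz'.trans_lt hx')
    rw [norm_pow, norm_norm] at h1
    have hC0 : 0 ≤ C * ‖z‖ ^ n := (norm_nonneg _).trans h1
    rcases le_or_gt 0 C with hC | hC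
    · exact h1.trans (by gcongr)
    · have hz0 : ‖z‖ ^ n = 0 := by
        by_contra hne
        have : 0 < ‖z‖ ^ n := lt_of_le_of_ne (by positivity) (Ne.symm hne)
        nlinarith
      have hx0 := hball x (by simpa using hx')
      rw [norm_pow, norm_norm] at hx0
      rw [hz0, mul_zero] at h1
      exact h1.trans ((norm_nonneg _).trans hx0)
  have h2 := (convex_closedBall (0 : E) ‖x‖).norm_image_sub_le_of_norm_fderiv_le
    (fun z _ => hf z) hb (x := 0) (y := x) (by simp) (by simp)
  rw [h0, sub_zero, sub_zero] at h2
  rw [norm_pow, norm_norm, pow_succ, ← mul_assoc]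
  exact h2

theorem fderiv_neg_of_odd {f : E → F} (h : ∀ x, f (-x) = -f x) (x : E) :
    fderiv ℝ f (-x) = fderiv ℝ f x := by
  have h1 : (fun x => f (-x)) = fun x => -f x := funext h
  have h2 : fderiv ℝ (fun x => f (-x)) x = -fderiv ℝ f (-x) := by
    simpa using fderiv_comp_smul (𝕜 := ℝ) (f := f) (x := x) (-1 : ℝ)
  rw [h1, fderiv_fun_neg] at h2
  exact (neg_injective h2).symm

theorem fderiv_zero_of_even {f : E → F} (h : ∀ x, f (-x) = f x) : fderiv ℝ f 0 = 0 := by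
  have h1 : (fun x => f (-x)) = fun x => f x := funext h
  have h2 : fderiv ℝ (fun x => f (-x)) 0 = -fderiv ℝ f 0 := by
    simpa using fderiv_comp_smul (𝕜 := ℝ) (f := f) (x := 0) (-1 : ℝ)
  rw [h1] at h2
  exact eq_zero_of_eq_neg h2

/-- A smooth odd function without linear part vanishes to third order. -/
theorem isBigO_cube_of_odd {f : E → F} (hf : ContDiff ℝ (⊤ : ℕ∞) f) (hodd : ∀ x, f (-x) = -f x)
    (h0 : fderiv ℝ f 0 = 0) : f =O[𝓝 0] fun x => ‖x‖ ^ 3 := by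
  have hf0 : f 0 = 0 := by
    have h := hodd 0
    rw [neg_zero] at h
    exact eq_zero_of_eq_neg h
  have hf1 : ContDiff ℝ (⊤ : ℕ∞) (fderiv ℝ f) := hf.fderiv_right (by simp)
  have hf2 : ContDiff ℝ (⊤ : ℕ∞) (fderiv ℝ (fderiv ℝ f)) := hf1.fderiv_right (by simp)
  -- The first derivative of an odd function is even, so the second one vanishes at `0` and is of
  -- first order; two integrations give the cube.
  have b2 : fderiv ℝ (fderiv ℝ f) =O[𝓝 0] fun x : E => ‖x‖ ^ 1 := by
    have h := ((hf2.differentiable (by simp)) 0).isBigO_sub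
    rw [fderiv_zero_of_even (fderiv_neg_of_odd hodd)] at h
    simpa using h.norm_right
  have b1 := isBigO_pow_succ_of_fderiv (hf1.differentiable (by simp)) h0 b2
  exact isBigO_pow_succ_of_fderiv (hf.differentiable (by simp)) hf0 b1

/-- A bound near the origin extends to bounded sets. -/
theorem exists_bound_of_isBigO {E F : Type*} [NormedAddCommGroup E] [ProperSpace E]
    [NormedAddCommGroup F] {f : E → F} (hf : Continuous f) {n : ℕ}
    (h : f =O[𝓝 0] fun x => ‖x‖ ^ n) (r : ℝ) :
    ∃ C, 0 ≤ C ∧ ∀ x, ‖x‖ ≤ r → ‖f x‖ ≤ C * ‖x‖ ^ n := by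
  obtain ⟨C, hC0, hC⟩ := h.exists_nonneg
  obtain ⟨δ, hδ, hball⟩ := Metric.eventually_nhds_iff_ball.1 hC.bound
  obtain ⟨M, hM⟩ := (isCompact_closedBall (0 : E) r).exists_bound_of_continuousOn hf.continuousOn
  -- `C` serves inside the ball of radius `δ`; outside it `‖x‖ ^ n ≥ δ ^ n` and the maximum over the
  -- compact ball serves.
  refine ⟨C + |M| / δ ^ n, by positivity, fun x hx => ?_⟩
  rcases lt_or_ge ‖x‖ δ with h1 | h1
  · have h2 := hball x (by simpa using h1)
    rw [norm_pow, norm_norm] at h2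
    refine h2.trans ?_
    gcongr
    exact le_add_of_nonneg_right (by positivity)
  · have h2 : ‖f x‖ ≤ |M| := (hM x (by simpa using hx)).trans (le_abs_self _)
    calc ‖f x‖ ≤ |M| / δ ^ n * δ ^ n := by rw [div_mul_cancel₀ _ (by positivity)]; exact h2
      _ ≤ (C + |M| / δ ^ n) * ‖x‖ ^ n := by
        gcongr
        exact le_add_of_nonneg_left hC0

end Taylor

section Symbol

variable {A : Site → Site → ℝ} {What : Matrix (Fin 2) (Fin 2) ℝ}

theorem continuous_symR (hA : DriftProperties A What) : Continuous (symR A) := by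
  have := hA.smooth.continuous
  unfold symR
  fun_prop

theorem symR_eq (k : Fin 2 → ℝ) : symR A k = 2 * (symbol A k).re := by
  rw [symR, symbol_neg, Complex.add_re, Complex.conj_re]
  ring

/-- The quadratic form `-(k, What k)`. -/
def quadForm (What : Matrix (Fin 2) (Fin 2) ℝ) (k : Fin 2 → ℝ) : ℝ := -(k ⬝ᵥ (What *ᵥ k))

theorem continuous_quadForm (What : Matrix (Fin 2) (Fin 2) ℝ) : Continuous (quadForm What) := by
  unfold quadForm
  fun_prop

theorem quadForm_smul (What : Matrix (Fin 2) (Fin 2) ℝ) (c : ℝ) (k : Fin 2 → ℝ) :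
    quadForm What (c • k) = c ^ 2 * quadForm What k := by
  simp only [quadForm, Matrix.mulVec_smul, smul_dotProduct, dotProduct_smul, smul_eq_mul]
  ring

theorem quadForm_pos (hW : (-What).PosDef) {k : Fin 2 → ℝ} (hk : k ≠ 0) : 0 < quadForm What k := by
  have h := hW.dotProduct_mulVec_pos hk
  rwa [Matrix.neg_mulVec, dotProduct_neg, star_trivial] at h

theorem exists_quadForm_bounds (hW : (-What).PosDef) :
    ∃ c C, 0 < c ∧ 0 ≤ C ∧ ∀ k, c * ‖k‖ ^ 2 ≤ quadForm What k ∧ quadForm What k ≤ C * ‖k‖ ^ 2 := by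
  have hS : IsCompact (Metric.sphere (0 : Fin 2 → ℝ) 1) := isCompact_sphere _ _
  have hne : (Metric.sphere (0 : Fin 2 → ℝ) 1).Nonempty := NormedSpace.sphere_nonempty.2 zero_le_one
  obtain ⟨k₁, hk₁, h₁⟩ := hS.exists_isMinOn hne (continuous_quadForm What).continuousOn
  obtain ⟨k₂, hk₂, h₂⟩ := hS.exists_isMaxOn hne (continuous_quadForm What).continuousOn
  have hs : ∀ k ∈ Metric.sphere (0 : Fin 2 → ℝ) 1, k ≠ 0 := fun k hk => by
    rintro rfl
    simp at hk
  refine ⟨quadForm What k₁, quadForm What k₂, quadForm_pos hW (hs _ hk₁),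
    (quadForm_pos hW (hs _ hk₂)).le, fun k => ?_⟩
  rcases eq_or_ne k 0 with rfl | hk
  · simp [quadForm]
  · have hk0 : 0 < ‖k‖ := norm_pos_iff.2 hk
    have hmem : ‖k‖⁻¹ • k ∈ Metric.sphere (0 : Fin 2 → ℝ) 1 := by
      rw [mem_sphere_zero_iff_norm, norm_smul, norm_inv, norm_norm, inv_mul_cancel₀ hk0.ne']
    have hq : quadForm What k = quadForm What (‖k‖⁻¹ • k) * ‖k‖ ^ 2 := by
      rw [quadForm_smul]
      field_simp
    rw [hq]
    exact ⟨mul_le_mul_of_nonneg_right (h₁ hmem) (by positivity),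
      mul_le_mul_of_nonneg_right (h₂ hmem) (by positivity)⟩

theorem exists_symR_sub_quadForm_bound (hA : DriftProperties A What) (r : ℝ) :
    ∃ C, 0 ≤ C ∧ ∀ k, ‖k‖ ≤ r → |symR A k + quadForm What k| ≤ C * ‖k‖ ^ 3 := by
  have h : (fun k => symR A k + quadForm What k) =O[𝓝 0] fun k => ‖k‖ ^ 3 := by
    simpa only [quadForm, ← sub_eq_add_neg] using hA.expansion
  exact exists_bound_of_isBigO ((continuous_symR hA).add (continuous_quadForm What)) h r

/-- Near the origin the quadratic part dominates; elsewhere in `[-π, π]²`, which is the sup norm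
ball of radius `π`, compactness and the absence of other zeros give a positive minimum. -/
theorem exists_symR_le (hA : DriftProperties A What) :
    ∃ c, 0 < c ∧ ∀ k, ‖k‖ ≤ Real.pi → c * ‖k‖ ^ 2 ≤ -symR A k := by
  obtain ⟨c₀, C₀, hc₀, hC₀, hq⟩ := exists_quadForm_bounds hA.negDef
  obtain ⟨C, hC0, hC⟩ := exists_symR_sub_quadForm_bound hA Real.pi
  -- Chosen so that the cubic error takes at most half of the quadratic lower bound; `C + 1` avoids
  -- division by zero.
  set δ : ℝ := c₀ / (2 * (C + 1)) with hδ
  have hδ0 : 0 < δ := by positivity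
  have hnear : ∀ k, ‖k‖ ≤ Real.pi → ‖k‖ ≤ δ → c₀ / 2 * ‖k‖ ^ 2 ≤ -symR A k := by
    intro k hk hkδ
    have h1 := (abs_le.1 (hC k hk)).2
    have h2 := (hq k).1
    have h3 : C * ‖k‖ ≤ c₀ / 2 := by
      calc C * ‖k‖ ≤ (C + 1) * δ := by
            apply mul_le_mul (by linarith) hkδ (norm_nonneg _) (by linarith)
        _ = c₀ / 2 := by rw [hδ]; field_simp
    nlinarith [mul_le_mul_of_nonneg_right h3 (sq_nonneg ‖k‖)]
  set K : Set (Fin 2 → ℝ) := Metric.closedBall 0 Real.pi ∩ {k | δ ≤ ‖k‖} with hK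
  have hKc : IsCompact K := (isCompact_closedBall _ _).inter_right
    (isClosed_le continuous_const continuous_norm)
  have hfar : ∃ m, 0 < m ∧ ∀ k ∈ K, m ≤ -symR A k := by
    rcases K.eq_empty_or_nonempty with he | hne
    · exact ⟨1, one_pos, by simp [he]⟩
    · obtain ⟨k₀, hk₀, hmin⟩ := hKc.exists_isMinOn hne (continuous_symR hA).neg.continuousOn
      refine ⟨-symR A k₀, ?_, fun k hk => hmin hk⟩
      have hn : ‖k₀‖ ≤ Real.pi := by simpa using hk₀.1
      refine neg_pos.2 (lt_of_le_of_ne (hA.symR_nonpos k₀) fun h0 => ?_)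
      have := hA.symR_zero k₀ (fun i => by
        have := (norm_le_pi_norm k₀ i).trans hn
        rw [Real.norm_eq_abs] at this
        exact abs_le.1 this) h0
      have h2 : δ ≤ ‖k₀‖ := hk₀.2
      rw [this, norm_zero] at h2
      linarith
  obtain ⟨m, hm, hmK⟩ := hfar
  refine ⟨min (c₀ / 2) (m / Real.pi ^ 2), by positivity, fun k hk => ?_⟩
  rcases le_total ‖k‖ δ with h | h
  · refine le_trans ?_ (hnear k hk h)
    gcongr
    exact min_le_left _ _
  · refine le_trans ?_ (hmK k ⟨by simpa using hk, h⟩)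
    calc min (c₀ / 2) (m / Real.pi ^ 2) * ‖k‖ ^ 2 ≤ m / Real.pi ^ 2 * Real.pi ^ 2 := by
          gcongr
          exact min_le_right _ _
      _ = m := by field_simp

/-- The phase of `e^{Â(k)}` in the frame moving with velocity `U`. -/
noncomputable def phase (A : Site → Site → ℝ) (k : Fin 2 → ℝ) : ℝ := (symbol A k).im + velU A ⬝ᵥ k

theorem contDiff_phase (hA : DriftProperties A What) : ContDiff ℝ (⊤ : ℕ∞) (phase A) := by
  have h1 : ContDiff ℝ (⊤ : ℕ∞) fun k => (symbol A k).im :=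
    Complex.imCLM.contDiff.comp hA.smooth
  refine h1.add ?_
  change ContDiff ℝ _ fun k : Fin 2 → ℝ => ∑ i, velU A i * k i
  fun_prop

/-- `A` is real, so `Im Â` is odd; its derivative at the origin is `-U`, and the linear part of the
phase cancels. An odd smooth function without linear part is cubic. -/
theorem exists_phase_bound (hA : DriftProperties A What) (r : ℝ) :
    ∃ C, 0 ≤ C ∧ ∀ k, ‖k‖ ≤ r → |phase A k| ≤ C * ‖k‖ ^ 3 := by
  refine exists_bound_of_isBigO (contDiff_phase hA).continuous
    (isBigO_cube_of_odd (contDiff_phase hA) (fun k => ?_) ?_) r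
  · simp only [phase, symbol_neg, Complex.conj_im, dotProduct_neg]
    ring
  · have hS : HasFDerivAt (symbol A) (fderiv ℝ (symbol A) 0) 0 :=
      ((hA.smooth.differentiable (by simp)) 0).hasFDerivAt
    let L : (Fin 2 → ℝ) →L[ℝ] ℝ := LinearMap.toContinuousLinearMap
      { toFun := fun k => velU A ⬝ᵥ k
        map_add' := dotProduct_add _
        map_smul' := fun c k => by simp [dotProduct_smul] }
    have h1 : HasFDerivAt (phase A) (Complex.imCLM.comp (fderiv ℝ (symbol A) 0) + L) 0 :=
      (Complex.imCLM.hasFDerivAt.comp (0 : Fin 2 → ℝ) hS).add L.hasFDerivAt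
    rw [h1.fderiv]
    have h2 : ∀ i, (Complex.imCLM.comp (fderiv ℝ (symbol A) 0) + L) (Pi.single i 1) = 0 := by
      intro i
      fin_cases i <;> simp [L, velU]
    ext k
    have hk : k = ∑ i, k i • (Pi.single i 1 : Fin 2 → ℝ) := by
      conv_lhs => rw [← Finset.univ_sum_single k]
      simp [← Pi.single_smul]
    rw [hk, map_sum]
    simp only [map_smul, h2]
    simp

end Symbol

end LinSDE

/-! ### Fourier representations of the limit covariance and the leading term. -/

namespace LinSDE

section FourierRepresentation

variable {A : Site → Site → ℝ} {What : Matrix (Fin 2) (Fin 2) ℝ}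

/-- `∫_0^s e^{-ρ u} du`. -/
noncomputable def timeInt (ρ s : ℝ) : ℝ := ∫ u in (0 : ℝ)..s, Real.exp (-ρ * u)

/-- The fundamental domain `(-π, π]²` of the dual lattice. -/
def brillouin : Set (Fin 2 → ℝ) := {k | ∀ i, k i ∈ Set.Ioc (-Real.pi) Real.pi}

theorem measurableSet_brillouin : MeasurableSet brillouin :=
  MeasurableSet.univ_pi' fun _ => measurableSet_Ioc

theorem norm_le_of_mem_brillouin {k : Fin 2 → ℝ} (hk : k ∈ brillouin) : ‖k‖ ≤ Real.pi := by
  rw [pi_norm_le_iff_of_nonneg Real.pi_pos.le]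
  intro i
  rw [Real.norm_eq_abs, abs_le]
  exact ⟨(hk i).1.le, (hk i).2⟩

open scoped Pointwise in
theorem smul_unitCube : (2 * Real.pi) • unitCube = brillouin := by
  have hp : 0 < 2 * Real.pi := by positivity
  ext k
  rw [Set.mem_smul_set_iff_inv_smul_mem₀ hp.ne']
  simp only [unitCube, brillouin, Set.mem_ofPred_eq, Set.mem_Ioc, Pi.smul_apply, smul_eq_mul]
  refine forall_congr' fun i => ?_
  rw [inv_mul_eq_div, lt_div_iff₀ hp, div_le_iff₀ hp]
  constructor <;> rintro ⟨h1, h2⟩ <;> constructor <;> linarith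

theorem mFourier_coe (n : Site) (x : Fin 2 → ℝ) :
    UnitAddTorus.mFourier n (fun i => (x i : UnitAddCircle))
      = Complex.exp (Complex.I * ((toVec n ⬝ᵥ ((2 * Real.pi) • x) : ℝ) : ℂ)) := by
  simp only [UnitAddTorus.mFourier, ContinuousMap.coe_mk, fourier_coe_apply, Fin.prod_univ_two,
    ← Complex.exp_add, dotProduct, toVec, Fin.sum_univ_two, Pi.smul_apply, smul_eq_mul]
  congr 1
  push_cast
  ring

theorem toVec_neg (y : Site) : toVec (-y) = -toVec y := by
  ext i
  simp [toVec]

theorem symbolTorus_coe (x : Fin 2 → ℝ) :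
    symbolTorus A (fun i => (x i : UnitAddCircle)) = symbol A ((2 * Real.pi) • x) := by
  unfold symbolTorus symbol
  refine tsum_congr fun r => ?_
  rw [mFourier_coe, toVec_neg, neg_dotProduct]
  push_cast
  ring_nf

/-- Substituting `r = s - u` leaves the rate `lam + conj lam = 2 Re lam` in `u`, and the excess time
`t - s` factors out. -/
theorem ouCov_conj {t s : ℝ≥0} (hst : s ≤ t) (lam : ℂ) :
    ouCov lam (starRingEnd ℂ lam) t s
      = Complex.exp ((t - s) * lam) * timeInt (-(2 * lam.re)) s := by
  rw [ouCov, timeInt, ← intervalIntegral.integral_ofReal, ← intervalIntegral.integral_const_mul]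
  have h1 : min (t : ℝ) s = s := min_eq_right hst
  rw [h1]
  have h2 := intervalIntegral.integral_comp_sub_left (a := 0) (b := (s : ℝ)) (fun u : ℝ =>
    Complex.exp ((t - s) * lam) * ((Real.exp (-(-(2 * lam.re)) * u) : ℝ) : ℂ)) (s : ℝ)
  rw [sub_self, sub_zero] at h2
  rw [← h2]
  refine intervalIntegral.integral_congr fun r _ => ?_
  rw [← Complex.exp_add, Complex.ofReal_exp, ← Complex.exp_add]
  congr 1
  have h3 := Complex.add_conj lam
  push_cast at h3 ⊢
  linear_combination ((s : ℂ) - r) * h3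

/-- The contribution of the lattice system to the remainder, in Fourier space. -/
noncomputable def latticePart (A : Site → Site → ℝ) (τ s : ℝ) (k : Fin 2 → ℝ) : ℂ :=
  brillouin.indicator (fun k => Complex.exp (τ * symbol A k) * timeInt (-symR A k) s) k

/-- The contribution of the Gaussian approximation to the remainder, in Fourier space. -/
noncomputable def gaussPart (A : Site → Site → ℝ) (What : Matrix (Fin 2) (Fin 2) ℝ) (τ s : ℝ)
    (k : Fin 2 → ℝ) : ℂ :=
  Complex.exp (-Complex.I * ((τ * (velU A ⬝ᵥ k) : ℝ) : ℂ)) *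
    ((Real.exp (-quadForm What k * (1 + τ / 2)) * timeInt (quadForm What k) s : ℝ) : ℂ)

open scoped Pointwise in
theorem limitCov_eq (v : ℝ) (y : Site) {t s : ℝ≥0} (hst : s ≤ t) :
    limitCov A v y t s = v / (4 * Real.pi ^ 2) *
      (∫ k, Complex.exp (-Complex.I * ((toVec y ⬝ᵥ k : ℝ) : ℂ)) * latticePart A (t - s) s k).re := by
  let G : (Fin 2 → ℝ) → ℂ := fun k => Complex.exp (-Complex.I * ((toVec y ⬝ᵥ k : ℝ) : ℂ)) *
    (Complex.exp ((t - s : ℝ) * symbol A k) * timeInt (-symR A k) s)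
  have h1 : torusMean (covDensity A y t s) = ∫ x in unitCube, G ((2 * Real.pi) • x) := by
    rw [torusMean]
    congr 1
    funext x
    rw [covDensity, mFourier_coe, symbolTorus_coe, ouCov_conj hst, toVec_neg, neg_dotProduct]
    simp only [G]
    rw [symR_eq]
    push_cast
    ring_nf
  rw [Measure.setIntegral_comp_smul_of_pos (volume : Measure (Fin 2 → ℝ)) G unitCube
    (R := 2 * Real.pi) (by positivity), smul_unitCube,
    ← integral_indicator measurableSet_brillouin] at h1
  have h2 : ∀ k, brillouin.indicator G k
      = Complex.exp (-Complex.I * ((toVec y ⬝ᵥ k : ℝ) : ℂ)) * latticePart A (t - s) s k := by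
    intro k
    by_cases hk : k ∈ brillouin <;> simp [latticePart, hk, G]
  simp_rw [h2] at h1
  rw [limitCov, h1, Complex.re_ofReal_mul, Complex.smul_re, smul_eq_mul]
  simp only [Module.finrank_fintype_fun_eq_card, Fintype.card_fin]
  ring

theorem integrable_exp_neg_quadForm (hW : (-What).PosDef) :
    Integrable fun k => Real.exp (-quadForm What k) := by
  obtain ⟨c, C, hc, -, hq⟩ := exists_quadForm_bounds hW
  -- The norm is the sup norm, so `∑ k_i² ≤ 2 ‖k‖²`; hence `c / 2`.
  have h := (GaussianFourier.integrable_cexp_neg_mul_sum_add (ι := Fin 2) (b := (c / 2 : ℝ))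
    (by rw [Complex.ofReal_re]; positivity) 0).norm
  refine h.mono' ((Real.continuous_exp.comp (continuous_quadForm What).neg).aestronglyMeasurable)
    (Eventually.of_forall fun k => ?_)
  rw [Real.norm_of_nonneg (Real.exp_pos _).le, Complex.norm_exp]
  have h1 : ∀ i, k i ^ 2 ≤ ‖k‖ ^ 2 := fun i => by
    rw [← sq_abs, ← Real.norm_eq_abs]
    gcongr
    exact norm_le_pi_norm k i
  have h2 : (-((c / 2 : ℝ) : ℂ) * ∑ i, (k i : ℂ) ^ 2 + ∑ i, (0 : Fin 2 → ℂ) i * k i).re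
      = -(c / 2 * ∑ i, k i ^ 2) := by
    have : (-((c / 2 : ℝ) : ℂ) * ∑ i, (k i : ℂ) ^ 2 + ∑ i, (0 : Fin 2 → ℂ) i * k i)
        = ((-(c / 2 * ∑ i, k i ^ 2) : ℝ) : ℂ) := by
      push_cast
      simp
    rw [this, Complex.ofReal_re]
  rw [h2, Real.exp_le_exp, Fin.sum_univ_two]
  nlinarith [(hq k).1, h1 0, h1 1]

variable {V : Matrix (Fin 2) (Fin 2) ℝ} {w : ℝ}

theorem abs_det_eq (hw : 0 < w) (hw2 : w ^ 2 = What.det) (hV : V * What * Vᵀ = -1) :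
    |V.det| = w⁻¹ := by
  have h := congrArg Matrix.det hV
  rw [Matrix.det_mul, Matrix.det_mul, Matrix.det_transpose, Matrix.det_neg, ← hw2] at h
  simp only [Fintype.card_fin, Matrix.det_one] at h
  have h2 : (|V.det| * w) ^ 2 = 1 := by
    rw [mul_pow, sq_abs]
    linarith
  have h3 : |V.det| * w = 1 := by
    have : 0 ≤ |V.det| * w := by positivity
    nlinarith
  field_simp
  exact h3

theorem quadForm_transpose_mulVec (hV : V * What * Vᵀ = -1) (x : Fin 2 → ℝ) :
    quadForm What (Vᵀ *ᵥ x) = ∑ i, x i ^ 2 := by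
  rw [quadForm, Matrix.mulVec_transpose, ← Matrix.dotProduct_mulVec, Matrix.mulVec_mulVec,
    ← Matrix.mulVec_transpose, Matrix.mulVec_mulVec, hV, Matrix.neg_mulVec,
    Matrix.one_mulVec, dotProduct_neg, neg_neg, dotProduct]
  simp only [sq]

/-- The Fourier transform of the Gaussian with quadratic form `quadForm What`. -/
theorem integral_gaussian (hw : 0 < w) (hw2 : w ^ 2 = What.det)
    (hV : V * What * Vᵀ = -1) (z : Fin 2 → ℝ) {a : ℝ} (ha : 0 < a) :
    ∫ k, Complex.exp (-Complex.I * ((z ⬝ᵥ k : ℝ) : ℂ)) * ((Real.exp (-quadForm What k * a) : ℝ) : ℂ)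
      = ((Real.pi / w * (Real.exp (-(∑ i, (V *ᵥ z) i ^ 2) / (4 * a)) / a) : ℝ) : ℂ) := by
  have hdet := abs_det_eq hw hw2 hV
  have hdet0 : Vᵀ.det ≠ 0 := by
    rw [Matrix.det_transpose]
    intro h0
    rw [h0, abs_zero] at hdet
    exact (inv_pos.2 hw).ne hdet
  set f : (Fin 2 → ℝ) → ℂ := fun k => Complex.exp (-Complex.I * ((z ⬝ᵥ k : ℝ) : ℂ)) *
    ((Real.exp (-quadForm What k * a) : ℝ) : ℂ) with hf
  have hfc : Continuous f := by
    have h1 := continuous_quadForm What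
    have h2 : Continuous fun k : Fin 2 → ℝ => z ⬝ᵥ k := by fun_prop
    fun_prop
  have hmap := Real.map_matrix_volume_pi_eq_smul_volume_pi hdet0
  -- The substitution `k = Vᵀ x` turns the quadratic form into the sum of squares, with Jacobian
  -- `|det V| = 1 / w`.
  have h1 : ∫ x, f (Matrix.toLin' Vᵀ x) = ∫ k, f k ∂(volume.map (Matrix.toLin' Vᵀ)) :=
    (integral_map (LinearMap.continuous_of_finiteDimensional _).aemeasurable
      hfc.aestronglyMeasurable).symm
  have habs : |(Vᵀ.det)⁻¹| = w := by
    rw [abs_inv, Matrix.det_transpose, hdet, inv_inv]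
  rw [hmap, integral_smul_measure, habs, ENNReal.toReal_ofReal hw.le] at h1
  have h2 : ∀ x : Fin 2 → ℝ, f (Matrix.toLin' Vᵀ x) = Complex.exp (-(a : ℂ) * ∑ i, (x i : ℂ) ^ 2
      + ∑ i, (-Complex.I * (V *ᵥ z) i) * x i) := by
    intro x
    simp only [hf, Matrix.toLin'_apply]
    rw [quadForm_transpose_mulVec hV, Matrix.mulVec_transpose, dotProduct_comm,
      ← Matrix.dotProduct_mulVec, Complex.ofReal_exp, ← Complex.exp_add, dotProduct_comm]
    congr 1
    simp only [dotProduct, Fin.sum_univ_two]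
    push_cast
    ring
  simp_rw [h2] at h1
  rw [GaussianFourier.integral_cexp_neg_mul_sum_add (by simpa using ha)] at h1
  have h3 : ∑ i, (-Complex.I * ((V *ᵥ z) i : ℂ)) ^ 2 = ((-∑ i, (V *ᵥ z) i ^ 2 : ℝ) : ℂ) := by
    simp only [Fin.sum_univ_two, mul_pow, neg_sq, Complex.I_sq]
    push_cast
    ring
  rw [h3] at h1
  have h4 : ((Real.pi : ℂ) / (a : ℂ)) ^ ((Fintype.card (Fin 2) : ℂ) / 2) = Real.pi / a := by
    simp
  rw [h4, Complex.real_smul] at h1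
  have hw0 : (w : ℂ) ≠ 0 := Complex.ofReal_ne_zero.2 hw.ne'
  have h5 : ∫ k, f k = (w : ℂ)⁻¹ * ((w : ℂ) * ∫ k, f k) := by field_simp
  rw [h5, ← h1]
  push_cast
  ring

/-- For each `a` the integrand is the Fourier transform of `e^{-q a}` at `z = y + τ U`. Exchanging
integrals, `∫ e^{-q a} da` from `1 + τ / 2` over a length `s` yields `e^{-q (1 + τ / 2)}` times
`timeInt q s`. Since `a ≥ 1`, the fixed Gaussian `e^{-q}` dominates. -/
theorem leadingTerm_eq (hW : (-What).PosDef) (hw : 0 < w) (hw2 : w ^ 2 = What.det)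
    (hV : V * What * Vᵀ = -1) (v : ℝ) (y : Site) {t s : ℝ≥0} (hst : s ≤ t) :
    leadingTerm A V v w t s y = v / (4 * Real.pi ^ 2) *
      (∫ k, Complex.exp (-Complex.I * ((toVec y ⬝ᵥ k : ℝ) : ℂ)) *
        gaussPart A What (t - s) s k).re := by
  set τ : ℝ := t - s with hτ
  have hτ0 : 0 ≤ τ := sub_nonneg.2 hst
  set z : Fin 2 → ℝ := toVec y + τ • velU A with hz
  have hH : vecH A V t s y = V *ᵥ z := by
    rw [vecH, hz, Matrix.mulVec_add, Matrix.mulVec_smul]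
  set a₀ : ℝ := 1 + τ / 2 with ha₀
  have hb : 1 + ((t : ℝ) + s) / 2 = a₀ + s := by rw [ha₀, hτ]; ring
  have hle : a₀ ≤ a₀ + s := le_add_of_nonneg_right s.coe_nonneg
  have hgauss : ∀ a ∈ Set.uIcc a₀ (a₀ + s),
      ((Real.exp (-(∑ i, vecH A V t s y i ^ 2) / (4 * a)) / a : ℝ) : ℂ)
        = ((w / Real.pi : ℝ) : ℂ) * ∫ k, Complex.exp (-Complex.I * ((z ⬝ᵥ k : ℝ) : ℂ)) *
          ((Real.exp (-quadForm What k * a) : ℝ) : ℂ) := by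
    intro a ha
    rw [Set.uIcc_of_le hle] at ha
    have ha' : 0 < a := by linarith [ha.1]
    rw [integral_gaussian hw hw2 hV z ha', hH, ← Complex.ofReal_mul]
    congr 1
    field_simp
  have hint : Integrable (Function.uncurry fun (a : ℝ) (k : Fin 2 → ℝ) =>
      Complex.exp (-Complex.I * ((z ⬝ᵥ k : ℝ) : ℂ)) *
        ((Real.exp (-quadForm What k * a) : ℝ) : ℂ))
      ((volume.restrict (Set.Ioc a₀ (a₀ + s))).prod volume) := by
    have hg : Integrable (fun p : ℝ × (Fin 2 → ℝ) => Real.exp (-quadForm What p.2))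
        ((volume.restrict (Set.Ioc a₀ (a₀ + s))).prod volume) :=
      (integrable_exp_neg_quadForm hW).comp_snd _
    refine hg.mono' ?_ ?_
    · have h1 := continuous_quadForm What
      have h2 : Continuous fun k : Fin 2 → ℝ => z ⬝ᵥ k := by fun_prop
      refine Continuous.aestronglyMeasurable ?_
      unfold Function.uncurry
      fun_prop
    · have h0 : ∀ᵐ a ∂(volume.restrict (Set.Ioc a₀ (a₀ + s))), a ∈ Set.Ioc a₀ (a₀ + (s : ℝ)) :=
        ae_restrict_mem measurableSet_Ioc
      filter_upwards [Measure.quasiMeasurePreserving_fst.ae h0] with p hp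
      simp only [Function.uncurry]
      rw [norm_mul, Complex.norm_exp, Complex.norm_real,
        Real.norm_of_nonneg (Real.exp_pos _).le]
      have hre : (-Complex.I * ((z ⬝ᵥ p.2 : ℝ) : ℂ)).re = 0 := by simp
      rw [hre, Real.exp_zero, one_mul, Real.exp_le_exp]
      have hq : 0 ≤ quadForm What p.2 := by
        rcases eq_or_ne p.2 0 with h | h
        · rw [h]; simp [quadForm]
        · exact (quadForm_pos hW h).le
      have h1 : 1 ≤ p.1 := by linarith [hp.1]
      nlinarith
  have hmain : ((∫ a in a₀..(a₀ + s), Real.exp (-(∑ i, vecH A V t s y i ^ 2) / (4 * a)) / a : ℝ) : ℂ)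
      = ((w / Real.pi : ℝ) : ℂ) * ∫ k, Complex.exp (-Complex.I * ((toVec y ⬝ᵥ k : ℝ) : ℂ)) *
        gaussPart A What τ s k := by
    rw [← intervalIntegral.integral_ofReal, intervalIntegral.integral_congr hgauss,
      intervalIntegral.integral_const_mul, intervalIntegral.integral_of_le hle,
      integral_integral_swap hint]
    congr 2
    funext k
    rw [integral_const_mul, ← intervalIntegral.integral_of_le hle,
      intervalIntegral.integral_ofReal, gaussPart]
    have h1 : ∫ a in a₀..(a₀ + s), Real.exp (-quadForm What k * a)
        = Real.exp (-quadForm What k * a₀) * timeInt (quadForm What k) s := by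
      rw [timeInt, ← intervalIntegral.integral_const_mul]
      have h2 := intervalIntegral.integral_comp_add_left (a := 0) (b := (s : ℝ))
        (fun a => Real.exp (-quadForm What k * a)) a₀
      rw [add_zero] at h2
      rw [← h2]
      refine intervalIntegral.integral_congr fun u _ => ?_
      rw [← Real.exp_add]
      ring_nf
    rw [h1, ← mul_assoc, ← Complex.exp_add]
    congr 2
    rw [hz, add_dotProduct, smul_dotProduct, smul_eq_mul]
    push_cast
    ring
  have hre := congrArg Complex.re hmain
  rw [Complex.ofReal_re, Complex.re_ofReal_mul] at hre
  rw [leadingTerm, hb, ← hτ, ← ha₀, hre]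
  field_simp

end FourierRepresentation

end LinSDE

/-! ### The uniform integrable bound in Fourier space. -/

namespace LinSDE

section Estimates

/-- Mean value inequality on the half-plane `Re z ≤ -m`, which is convex and where `|exp z| ≤
e^{-m}`. -/
theorem norm_cexp_sub_cexp_le {m : ℝ} {a b : ℂ} (ha : a.re ≤ -m) (hb : b.re ≤ -m) :
    ‖Complex.exp a - Complex.exp b‖ ≤ Real.exp (-m) * ‖a - b‖ :=
  (convex_halfSpace_re_le (-m)).norm_image_sub_le_of_norm_hasDerivWithin_le
    (fun z _ => (Complex.hasDerivAt_exp z).hasDerivWithinAt)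
    (fun z hz => by rw [Complex.norm_exp]; exact Real.exp_le_exp.2 hz) hb ha

theorem abs_exp_sub_exp_le {m a b : ℝ} (ha : a ≤ -m) (hb : b ≤ -m) :
    |Real.exp a - Real.exp b| ≤ Real.exp (-m) * |a - b| := by
  have h := norm_cexp_sub_cexp_le (a := a) (b := b) (by simpa using ha) (by simpa using hb)
  rw [← Complex.ofReal_exp, ← Complex.ofReal_exp, ← Complex.ofReal_sub, ← Complex.ofReal_sub,
    Complex.norm_real, Complex.norm_real] at h
  exact h

/-- Written through `e^{-s}`, which stays in `[0, 1]` for `s ≥ 0`, so that the limit `s → ∞` becomes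
the value `0` of this variable. -/
theorem timeInt_eq {ρ : ℝ} (hρ : ρ ≠ 0) (s : ℝ) :
    timeInt ρ s = (1 - Real.exp (-s) ^ ρ) / ρ := by
  have hd : ∀ u ∈ Set.uIcc 0 s, HasDerivAt (fun u => -Real.exp (-ρ * u) / ρ)
      (Real.exp (-ρ * u)) u := by
    intro u _
    have h := ((((hasDerivAt_id u).const_mul (-ρ)).exp).neg).div_const ρ
    refine h.congr_deriv ?_
    simp only [id]
    field_simp
  rw [timeInt, intervalIntegral.integral_eq_sub_of_hasDerivAt hd
    (Continuous.intervalIntegrable (by fun_prop) _ _), ← Real.exp_mul]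
  rw [mul_zero, Real.exp_zero, neg_mul, neg_mul, mul_comm s]
  ring

theorem timeInt_nonneg (ρ : ℝ) {s : ℝ} (hs : 0 ≤ s) : 0 ≤ timeInt ρ s :=
  intervalIntegral.integral_nonneg hs fun _ _ => (Real.exp_pos _).le

theorem timeInt_le_time {ρ s : ℝ} (hρ : 0 ≤ ρ) (hs : 0 ≤ s) : timeInt ρ s ≤ s := by
  have h := intervalIntegral.integral_mono_on (μ := volume) hs
    (f := fun u => Real.exp (-ρ * u)) (g := fun _ => (1 : ℝ))
    (Continuous.intervalIntegrable (by fun_prop) _ _)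
    (Continuous.intervalIntegrable (by fun_prop) _ _) fun u hu => by
      rw [Real.exp_le_one_iff]
      nlinarith [hu.1]
  simpa [timeInt] using h

theorem timeInt_le_inv {ρ : ℝ} (hρ : 0 < ρ) (s : ℝ) : timeInt ρ s ≤ 1 / ρ := by
  rw [timeInt_eq hρ.ne']
  gcongr
  have : 0 ≤ Real.exp (-s) ^ ρ := by positivity
  linarith

/-- The integrands differ by at most `|ρ - q| u e^{-κ u}`, and `u e^{-κ u}` has total integral `1 /
κ²`; so the bound is uniform in `s`. -/
theorem abs_timeInt_sub_le {κ ρ q s : ℝ} (hκ : 0 < κ) (hρ : κ ≤ ρ) (hq : κ ≤ q) (hs : 0 ≤ s) :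
    |timeInt ρ s - timeInt q s| ≤ |ρ - q| / κ ^ 2 := by
  have hd : ∀ u ∈ Set.uIcc 0 s, HasDerivAt
      (fun u => -((u / κ + 1 / κ ^ 2) * Real.exp (-κ * u))) (u * Real.exp (-κ * u)) u := by
    intro u _
    have h1 : HasDerivAt (fun u : ℝ => u / κ + 1 / κ ^ 2) (1 / κ) u :=
      ((hasDerivAt_id u).div_const κ).add_const _
    have h2 := (h1.mul ((hasDerivAt_id u).const_mul (-κ)).exp).neg
    refine h2.congr_deriv ?_
    simp only [id]
    field_simp
    ring
  have hcont : Continuous fun u : ℝ => u * Real.exp (-κ * u) := by fun_prop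
  have h1 := intervalIntegral.integral_eq_sub_of_hasDerivAt hd (hcont.intervalIntegrable _ _)
  rw [timeInt, timeInt, ← intervalIntegral.integral_sub
    (Continuous.intervalIntegrable (by fun_prop) _ _)
    (Continuous.intervalIntegrable (by fun_prop) _ _), ← Real.norm_eq_abs]
  have h2 : ‖∫ u in (0 : ℝ)..s, (Real.exp (-ρ * u) - Real.exp (-q * u))‖
      ≤ ∫ u in (0 : ℝ)..s, |ρ - q| * (u * Real.exp (-κ * u)) := by
    refine intervalIntegral.norm_integral_le_of_norm_le hs ?_
      ((hcont.const_mul _).intervalIntegrable _ _)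
    refine Eventually.of_forall fun u hu => ?_
    have h := abs_exp_sub_exp_le (m := κ * u) (a := -ρ * u) (b := -q * u)
      (by nlinarith [hu.1]) (by nlinarith [hu.1])
    rw [Real.norm_eq_abs]
    refine h.trans (le_of_eq ?_)
    rw [show -ρ * u - -q * u = -((ρ - q) * u) by ring, abs_neg, abs_mul, abs_of_pos hu.1]
    ring_nf
  refine h2.trans ?_
  have h3 : 0 ≤ (s / κ + 1 / κ ^ 2) * Real.exp (-κ * s) := by positivity
  rw [intervalIntegral.integral_const_mul, h1, div_eq_mul_one_div |ρ - q|]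
  refine mul_le_mul_of_nonneg_left ?_ (abs_nonneg _)
  simp only [zero_div, zero_add, mul_zero, Real.exp_zero, mul_one]
  linarith

theorem mul_exp_neg_le {c : ℝ} (hc : 0 < c) (x : ℝ) : x * Real.exp (-(c * x)) ≤ 1 / c := by
  have h := Real.add_one_le_exp (c * x)
  have h2 : c * x * Real.exp (-(c * x)) ≤ 1 := by
    calc c * x * Real.exp (-(c * x)) ≤ Real.exp (c * x) * Real.exp (-(c * x)) := by
          gcongr
          linarith
      _ = 1 := by rw [← Real.exp_add]; simp
  rw [le_div_iff₀ hc]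
  linarith

end Estimates

section Difference

variable {A : Site → Site → ℝ} {What : Matrix (Fin 2) (Fin 2) ℝ}

/-- The remainder in Fourier space. -/
noncomputable def diffPart (A : Site → Site → ℝ) (What : Matrix (Fin 2) (Fin 2) ℝ) (τ s : ℝ)
    (k : Fin 2 → ℝ) : ℂ :=
  latticePart A τ s k - gaussPart A What τ s k

/-- Isolates the drift factor shared with `gaussPart`, leaving a phase of third order. -/
theorem cexp_symbol_eq (τ : ℝ) (k : Fin 2 → ℝ) :
    Complex.exp (τ * symbol A k) = Complex.exp (-Complex.I * ((τ * (velU A ⬝ᵥ k) : ℝ) : ℂ)) *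
      Complex.exp (((-(-symR A k) * τ / 2 : ℝ) : ℂ) + Complex.I * ((τ * phase A k : ℝ) : ℂ)) := by
  rw [← Complex.exp_add]
  congr 1
  rw [symR_eq, phase]
  conv_lhs => rw [← Complex.re_add_im (symbol A k)]
  push_cast
  ring

theorem norm_gaussPart {τ s : ℝ} (hs : 0 ≤ s) (k : Fin 2 → ℝ) :
    ‖gaussPart A What τ s k‖
      = Real.exp (-quadForm What k * (1 + τ / 2)) * timeInt (quadForm What k) s := by
  rw [gaussPart, norm_mul, Complex.norm_real, Complex.norm_exp, Real.norm_of_nonneg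
    (mul_nonneg (Real.exp_pos _).le (timeInt_nonneg _ hs))]
  simp

theorem norm_latticePart_le {τ s : ℝ} (hs : 0 ≤ s) (k : Fin 2 → ℝ) :
    ‖latticePart A τ s k‖ ≤ Real.exp (-(-symR A k) * τ / 2) * timeInt (-symR A k) s := by
  rw [latticePart]
  refine (norm_indicator_le_norm_self _ _).trans ?_
  rw [norm_mul, Complex.norm_real, Complex.norm_exp, Real.norm_of_nonneg (timeInt_nonneg _ hs),
    symR_eq]
  refine le_of_eq ?_
  congr 2
  simp
  ring

theorem quadForm_nonneg (hW : (-What).PosDef) (k : Fin 2 → ℝ) : 0 ≤ quadForm What k := by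
  rcases eq_or_ne k 0 with rfl | h
  · simp [quadForm]
  · exact (quadForm_pos hW h).le

theorem integrable_const_div_norm (K r : ℝ) :
    IntegrableOn (fun k : Fin 2 → ℝ => K / ‖k‖) (Metric.ball 0 r) := by
  refine integrableOn_ball_of_norm_le_rpow (C := |K|) (α := 1) (by simp) (by simp)
    (Eventually.of_forall fun k => ?_) (Measurable.aestronglyMeasurable (by fun_prop))
  rw [Real.rpow_neg_one, norm_div, norm_norm, Real.norm_eq_abs, div_eq_mul_inv]

/-- An integrable bound, uniform in both times, for the remainder in Fourier space. -/
theorem exists_dominating (hA : DriftProperties A What) :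
    ∃ G : (Fin 2 → ℝ) → ℝ, Integrable G ∧ ∀ τ s : ℝ, 0 ≤ τ → 0 ≤ s → ∀ k, k ≠ 0 →
      ‖diffPart A What τ s k‖ ≤ G k := by
  obtain ⟨c₁, C₂, hc₁, hC₂, hq⟩ := exists_quadForm_bounds hA.negDef
  obtain ⟨c₂, hc₂, hR⟩ := exists_symR_le hA
  obtain ⟨C₁, hC₁, hRq⟩ := exists_symR_sub_quadForm_bound hA Real.pi
  obtain ⟨C₃, hC₃, hph⟩ := exists_phase_bound hA Real.pi
  set c := min c₁ c₂ with hc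
  have hc0 : 0 < c := lt_min hc₁ hc₂
  -- The terms come from the cubic errors in the exponent, from the cutoff `e^{-q}`, and from the
  -- change of rate in `timeInt`; each is divided by the appropriate power of `κ = c ‖k‖²`.
  set K : ℝ := (2 * (C₁ + C₃) / c + C₂ * Real.pi) / c + C₁ / c ^ 2 with hK
  have hK0 : 0 ≤ K := by positivity
  -- The first term serves the zone, contained in this open ball; the second serves its complement,
  -- where only the Gaussian part survives.
  refine ⟨fun k => (Metric.ball 0 (Real.pi + 1)).indicator (fun k => K / ‖k‖) k
    + Real.exp (-quadForm What k) * (1 / (c * Real.pi ^ 2)), ?_, fun τ s hτ hs k hk => ?_⟩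
  · exact ((integrable_const_div_norm K (Real.pi + 1)).integrable_indicator
      Metric.isOpen_ball.measurableSet).add
      ((integrable_exp_neg_quadForm hA.negDef).mul_const _)
  · have hn : 0 < ‖k‖ := norm_pos_iff.2 hk
    set κ : ℝ := c * ‖k‖ ^ 2 with hκ
    have hκ0 : 0 < κ := by positivity
    have hqκ : κ ≤ quadForm What k := by
      refine le_trans ?_ (hq k).1
      rw [hκ]
      gcongr
      exact min_le_left _ _
    by_cases hkB : k ∈ brillouin
    · have hkπ := norm_le_of_mem_brillouin hkB
      set ρ : ℝ := -symR A k with hρ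
      set q : ℝ := quadForm What k with hqd
      have hρκ : κ ≤ ρ := by
        refine le_trans ?_ (hR k hkπ)
        rw [hκ]
        gcongr
        exact min_le_right _ _
      have hρq : |ρ - q| ≤ C₁ * ‖k‖ ^ 3 := by
        have h := hRq k hkπ
        rwa [show ρ - q = -(symR A k + quadForm What k) by rw [hρ, hqd]; ring, abs_neg]
      set α : ℂ := ((-ρ * τ / 2 : ℝ) : ℂ) + Complex.I * ((τ * phase A k : ℝ) : ℂ) with hα
      set β : ℝ := -q * (1 + τ / 2) with hβ
      -- Exponentials and time integrals are exchanged one at a time: the first difference is of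
      -- order `‖k‖` against `‖k‖⁻²`, the second of order `‖k‖³ / ‖k‖⁴`.
      have hdiff : diffPart A What τ s k = Complex.exp (-Complex.I * ((τ * (velU A ⬝ᵥ k) : ℝ) : ℂ))
          * ((Complex.exp α - Complex.exp β) * timeInt ρ s
            + Complex.exp β * ((timeInt ρ s - timeInt q s : ℝ) : ℂ)) := by
        rw [diffPart, latticePart, Set.indicator_of_mem hkB, cexp_symbol_eq, gaussPart, ← hρ,
          ← hα, ← hqd, ← hβ, Complex.ofReal_mul (Real.exp β), Complex.ofReal_exp,
          Complex.ofReal_sub]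
        ring
      have hre : (-Complex.I * ((τ * (velU A ⬝ᵥ k) : ℝ) : ℂ)).re = 0 := by simp
      have hαre : α.re = -ρ * τ / 2 := by simp [hα]
      have hE1 : ‖Complex.exp α - Complex.exp β‖ ≤ 2 * (C₁ + C₃) / c * ‖k‖ + C₂ * ‖k‖ ^ 2 := by
        have h1 : ‖Complex.exp α - Complex.exp β‖ ≤ Real.exp (-(κ * τ / 2)) * ‖α - β‖ := by
          refine norm_cexp_sub_cexp_le ?_ ?_
          · rw [hαre]; nlinarith
          · rw [Complex.ofReal_re, hβ]; nlinarith
        have h2 : ‖α - β‖ ≤ (C₁ + C₃) * ‖k‖ ^ 3 * τ + C₂ * ‖k‖ ^ 2 := by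
          have : α - β = (((q - ρ) * (τ / 2) + q : ℝ) : ℂ)
              + Complex.I * ((τ * phase A k : ℝ) : ℂ) := by
            rw [hα, hβ]; push_cast; ring
          rw [this]
          refine (norm_add_le _ _).trans ?_
          rw [norm_mul, Complex.norm_I, one_mul, Complex.norm_real, Complex.norm_real,
            Real.norm_eq_abs, Real.norm_eq_abs, abs_mul τ, abs_of_nonneg hτ]
          have h3 : |(q - ρ) * (τ / 2) + q| ≤ C₁ * ‖k‖ ^ 3 * (τ / 2) + C₂ * ‖k‖ ^ 2 := by
            refine (abs_add_le _ _).trans ?_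
            rw [abs_mul, abs_of_nonneg (by positivity : 0 ≤ τ / 2), abs_sub_comm,
              abs_of_nonneg (hκ0.le.trans hqκ)]
            gcongr
            exact (hq k).2
          have h4 : τ * |phase A k| ≤ τ * (C₃ * ‖k‖ ^ 3) := by
            gcongr
            exact hph k hkπ
          have h5 : 0 ≤ C₁ * ‖k‖ ^ 3 * (τ / 2) := by positivity
          linarith
        -- The error in the exponent grows with `τ`; half of the decay rate absorbs this at the
        -- price of `2 / κ`, which makes the bound uniform in `τ`.
        have h3 : τ * Real.exp (-(κ * τ / 2)) ≤ 2 / κ := by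
          have h := mul_exp_neg_le (c := κ / 2) (by positivity) τ
          have e1 : κ * τ / 2 = κ / 2 * τ := by ring
          rw [e1]
          refine h.trans (le_of_eq ?_)
          field_simp
        have h4 : Real.exp (-(κ * τ / 2)) ≤ 1 := by
          rw [Real.exp_le_one_iff]
          have : 0 ≤ κ * τ := by positivity
          linarith
        calc ‖Complex.exp α - Complex.exp β‖
            ≤ Real.exp (-(κ * τ / 2)) * ((C₁ + C₃) * ‖k‖ ^ 3 * τ + C₂ * ‖k‖ ^ 2) :=
              h1.trans (by gcongr)
          _ = (C₁ + C₃) * ‖k‖ ^ 3 * (τ * Real.exp (-(κ * τ / 2)))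
              + Real.exp (-(κ * τ / 2)) * (C₂ * ‖k‖ ^ 2) := by ring
          _ ≤ (C₁ + C₃) * ‖k‖ ^ 3 * (2 / κ) + 1 * (C₂ * ‖k‖ ^ 2) := by gcongr
          _ = 2 * (C₁ + C₃) / c * ‖k‖ + C₂ * ‖k‖ ^ 2 := by
            rw [hκ]
            field_simp
      have hT : timeInt ρ s ≤ 1 / κ :=
        (timeInt_le_inv (hκ0.trans_le hρκ) s).trans (by gcongr)
      have hTd : |timeInt ρ s - timeInt q s| ≤ C₁ * ‖k‖ ^ 3 / κ ^ 2 :=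
        (abs_timeInt_sub_le hκ0 hρκ hqκ hs).trans (by gcongr)
      have hβ1 : Real.exp β ≤ 1 := by
        rw [Real.exp_le_one_iff, hβ]
        have : 0 ≤ q * (1 + τ / 2) := mul_nonneg (hκ0.le.trans hqκ) (by positivity)
        linarith
      have hbound : ‖diffPart A What τ s k‖ ≤ K / ‖k‖ := by
        rw [hdiff, norm_mul, Complex.norm_exp, hre, Real.exp_zero, one_mul]
        refine (norm_add_le _ _).trans ?_
        rw [norm_mul, norm_mul, Complex.norm_real, Complex.norm_real,
          Real.norm_of_nonneg (timeInt_nonneg _ hs), ← Complex.ofReal_exp, Complex.norm_real,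
          Real.norm_of_nonneg (Real.exp_pos _).le, Real.norm_eq_abs]
        have hT0 := timeInt_nonneg ρ hs
        calc _ ≤ (2 * (C₁ + C₃) / c * ‖k‖ + C₂ * ‖k‖ ^ 2) * (1 / κ)
              + 1 * (C₁ * ‖k‖ ^ 3 / κ ^ 2) := by gcongr; rwa [Complex.ofReal_exp]
          _ = (2 * (C₁ + C₃) / c + C₂ * ‖k‖) / c / ‖k‖ + C₁ / c ^ 2 / ‖k‖ := by
            rw [hκ]
            field_simp
          _ ≤ (2 * (C₁ + C₃) / c + C₂ * Real.pi) / c / ‖k‖ + C₁ / c ^ 2 / ‖k‖ := by gcongr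
          _ = K / ‖k‖ := by rw [hK]; ring
      refine hbound.trans ?_
      have hmem : k ∈ Metric.ball (0 : Fin 2 → ℝ) (Real.pi + 1) := by
        rw [mem_ball_zero_iff]
        linarith
      simp only [Set.indicator_of_mem hmem]
      exact le_add_of_nonneg_right (by positivity)
    · have hkπ : Real.pi ≤ ‖k‖ := by
        by_contra h
        push Not at h
        refine hkB fun i => ?_
        have h1 := (norm_le_pi_norm k i).trans_lt h
        rw [Real.norm_eq_abs, abs_lt] at h1
        exact ⟨h1.1, h1.2.le⟩
      rw [diffPart, latticePart, Set.indicator_of_notMem hkB, zero_sub, norm_neg,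
        norm_gaussPart hs]
      have h1 : timeInt (quadForm What k) s ≤ 1 / (c * Real.pi ^ 2) :=
        (timeInt_le_inv (hκ0.trans_le hqκ) s).trans (by
          have : c * Real.pi ^ 2 ≤ quadForm What k := le_trans (by rw [hκ]; gcongr) hqκ
          gcongr)
      have h2 : Real.exp (-quadForm What k * (1 + τ / 2)) ≤ Real.exp (-quadForm What k) := by
        rw [Real.exp_le_exp]
        have := mul_nonneg (hκ0.le.trans hqκ) hτ
        linarith
      have h3 := timeInt_nonneg (quadForm What k) hs
      refine le_trans ?_ (le_add_of_nonneg_left (Set.indicator_nonneg (fun k _ => by positivity) k))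
      gcongr

end Difference

end LinSDE

/-! ### Boundedness and decay of the remainder. -/

namespace LinSDE

section Limits

variable {A : Site → Site → ℝ} {What : Matrix (Fin 2) (Fin 2) ℝ}

theorem aestronglyMeasurable_gaussPart (What : Matrix (Fin 2) (Fin 2) ℝ) (τ s : ℝ) :
    AEStronglyMeasurable (gaussPart A What τ s) := by
  have h1 := continuous_quadForm What
  have h2 : Continuous fun k : Fin 2 → ℝ => velU A ⬝ᵥ k := by fun_prop
  have h3 : Continuous fun k => timeInt (quadForm What k) s := by
    unfold timeInt
    exact intervalIntegral.continuous_parametric_intervalIntegral_of_continuous' (by fun_prop) _ _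
  refine Continuous.aestronglyMeasurable ?_
  unfold gaussPart
  fun_prop

theorem aestronglyMeasurable_latticePart (hA : DriftProperties A What) (τ s : ℝ) :
    AEStronglyMeasurable (latticePart A τ s) := by
  have h1 := continuous_symR hA
  have h2 := hA.smooth.continuous
  have h3 : Continuous fun k => timeInt (-symR A k) s := by
    unfold timeInt
    exact intervalIntegral.continuous_parametric_intervalIntegral_of_continuous' (by fun_prop) _ _
  refine AEStronglyMeasurable.indicator (Continuous.aestronglyMeasurable ?_) measurableSet_brillouin
  fun_prop

theorem integrable_gaussPart (hW : (-What).PosDef) {τ s : ℝ} (hτ : 0 ≤ τ) (hs : 0 ≤ s) :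
    Integrable (gaussPart A What τ s) := by
  refine ((integrable_exp_neg_quadForm hW).mul_const s).mono'
    (aestronglyMeasurable_gaussPart What τ s) (Eventually.of_forall fun k => ?_)
  rw [norm_gaussPart hs]
  have hq := quadForm_nonneg hW k
  have h1 : Real.exp (-quadForm What k * (1 + τ / 2)) ≤ Real.exp (-quadForm What k) := by
    rw [Real.exp_le_exp]
    have := mul_nonneg hq hτ
    linarith
  exact mul_le_mul h1 (timeInt_le_time hq hs) (timeInt_nonneg _ hs) (Real.exp_pos _).le

theorem symR_neg_of_mem (hA : DriftProperties A What) {k : Fin 2 → ℝ} (hk : k ∈ brillouin)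
    (hk0 : k ≠ 0) : 0 < -symR A k :=
  neg_pos.2 (lt_of_le_of_ne (hA.symR_nonpos k) fun h =>
    hk0 (hA.symR_zero k (fun i => ⟨(hk i).1.le, (hk i).2⟩) h))

/-- At a fixed nonzero frequency both parts decay exponentially in `τ`, while their time integrals
are bounded independently of `s`. -/
theorem tendsto_diffPart_zero (hA : DriftProperties A What) {τ s : ℕ → ℝ}
    (hτ : Tendsto τ atTop atTop) (hs : ∀ n, 0 ≤ s n) {k : Fin 2 → ℝ} (hk : k ≠ 0) :
    Tendsto (fun n => diffPart A What (τ n) (s n) k) atTop (𝓝 0) := by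
  have hexp : ∀ ρ : ℝ, 0 < ρ → Tendsto (fun n => Real.exp (-ρ * τ n / 2)) atTop (𝓝 0) := by
    intro ρ hρ
    rw [Real.tendsto_exp_comp_nhds_zero]
    have h := hτ.const_mul_atTop_of_neg (r := -ρ / 2) (by linarith)
    refine h.congr fun n => ?_
    ring
  have hq := quadForm_pos hA.negDef hk
  have h1 : Tendsto (fun n => gaussPart A What (τ n) (s n) k) atTop (𝓝 0) := by
    refine squeeze_zero_norm (fun n => ?_)
      ((mul_zero (1 / quadForm What k)) ▸ (hexp _ hq).const_mul (1 / quadForm What k))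
    rw [norm_gaussPart (hs n), mul_comm]
    refine mul_le_mul (timeInt_le_inv hq _) ?_ (Real.exp_pos _).le (by positivity)
    rw [Real.exp_le_exp]
    linarith
  have h2 : Tendsto (fun n => latticePart A (τ n) (s n) k) atTop (𝓝 0) := by
    by_cases hkB : k ∈ brillouin
    · have hρ := symR_neg_of_mem hA hkB hk
      refine squeeze_zero_norm (fun n => ?_)
        ((mul_zero (1 / (-symR A k))) ▸ (hexp _ hρ).const_mul (1 / (-symR A k)))
      refine (norm_latticePart_le (hs n) k).trans ?_
      rw [mul_comm]
      gcongr
      exact timeInt_le_inv hρ _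
    · simp only [latticePart, Set.indicator_of_notMem hkB]
      exact tendsto_const_nhds
  simpa [diffPart] using h2.sub h1

/-- Only `e^{-s}` is required to converge, so `s → ∞` is included as `σ = 0`; positive rates keep `σ
^ ρ` continuous there. -/
theorem exists_tendsto_diffPart (hA : DriftProperties A What) {τ s : ℕ → ℝ} {τ₀ σ : ℝ}
    (hτ : Tendsto τ atTop (𝓝 τ₀)) (hs : Tendsto (fun n => Real.exp (-s n)) atTop (𝓝 σ)) :
    ∃ f : (Fin 2 → ℝ) → ℂ, ∀ k, k ≠ 0 →
      Tendsto (fun n => diffPart A What (τ n) (s n) k) atTop (𝓝 (f k)) := by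
  have htime : ∀ ρ : ℝ, 0 < ρ →
      Tendsto (fun n => timeInt ρ (s n)) atTop (𝓝 ((1 - σ ^ ρ) / ρ)) := by
    intro ρ hρ
    simp_rw [timeInt_eq hρ.ne']
    exact ((hs.rpow_const (Or.inr hρ.le)).const_sub 1).div_const ρ
  refine ⟨fun k => brillouin.indicator (fun k => Complex.exp (τ₀ * symbol A k) *
      (((1 - σ ^ (-symR A k)) / (-symR A k) : ℝ) : ℂ)) k
    - Complex.exp (-Complex.I * ((τ₀ * (velU A ⬝ᵥ k) : ℝ) : ℂ)) *
      ((Real.exp (-quadForm What k * (1 + τ₀ / 2)) *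
        ((1 - σ ^ quadForm What k) / quadForm What k) : ℝ) : ℂ), fun k hk => ?_⟩
  refine Tendsto.sub ?_ ?_
  · by_cases hkB : k ∈ brillouin
    · simp only [latticePart, Set.indicator_of_mem hkB]
      refine Tendsto.mul ?_ ((Complex.continuous_ofReal.tendsto _).comp
        (htime _ (symR_neg_of_mem hA hkB hk)))
      have hc : Continuous fun x : ℝ => Complex.exp (x * symbol A k) := by fun_prop
      exact (hc.tendsto τ₀).comp hτ
    · simp only [latticePart, Set.indicator_of_notMem hkB]
      exact tendsto_const_nhds
  · have hc1 : Continuous fun x : ℝ =>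
      Complex.exp (-Complex.I * ((x * (velU A ⬝ᵥ k) : ℝ) : ℂ)) := by fun_prop
    have hc2 : Continuous fun x : ℝ => Real.exp (-quadForm What k * (1 + x / 2)) := by fun_prop
    exact ((hc1.tendsto τ₀).comp hτ).mul ((Complex.continuous_ofReal.tendsto _).comp
      (((hc2.tendsto τ₀).comp hτ).mul (htime _ (quadForm_pos hA.negDef hk))))

theorem norm_cexp_site (y : Site) (k : Fin 2 → ℝ) :
    ‖Complex.exp (-Complex.I * ((toVec y ⬝ᵥ k : ℝ) : ℂ))‖ = 1 := by
  rw [Complex.norm_exp]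
  simp

theorem continuous_cexp_site (y : Site) :
    Continuous fun k : Fin 2 → ℝ => Complex.exp (-Complex.I * ((toVec y ⬝ᵥ k : ℝ) : ℂ)) := by
  have h : Continuous fun k : Fin 2 → ℝ => toVec y ⬝ᵥ k := by fun_prop
  fun_prop

/-- The Riemann–Lebesgue lemma along lattice frequencies. -/
theorem tendsto_integral_cexp_site (f : (Fin 2 → ℝ) → ℂ) {y : ℕ → Site}
    (hy : Tendsto (fun n => siteNorm (y n)) atTop atTop) :
    Tendsto (fun n => ∫ k, Complex.exp (-Complex.I * ((toVec (y n) ⬝ᵥ k : ℝ) : ℂ)) * f k)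
      atTop (𝓝 0) := by
  let L : Site → StrongDual ℝ (Fin 2 → ℝ) := fun y => LinearMap.toContinuousLinearMap
    { toFun := fun k => (2 * Real.pi)⁻¹ * (toVec y ⬝ᵥ k)
      map_add' := fun a b => by rw [dotProduct_add, mul_add]
      map_smul' := fun c k => by simp only [dotProduct_smul, smul_eq_mul, RingHom.id_apply]; ring }
  have hL : ∀ y k, L y k = (2 * Real.pi)⁻¹ * (toVec y ⬝ᵥ k) := fun _ _ => rfl
  -- Testing on the two unit vectors bounds each `|y_i|` by `2π ‖L y‖`, and `siteNorm y` is at most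
  -- the sum of the two.
  have hLnorm : ∀ y : Site, (4 * Real.pi)⁻¹ * siteNorm y ≤ ‖L y‖ := by
    intro y
    have h1 : ∀ i, (2 * Real.pi)⁻¹ * |(y i : ℝ)| ≤ ‖L y‖ := by
      intro i
      have h := (L y).le_opNorm (Pi.single i 1)
      rw [hL, dotProduct_single_one, Pi.norm_single, norm_one, mul_one, norm_mul, Real.norm_eq_abs,
        abs_of_pos (by positivity), Real.norm_eq_abs] at h
      exact h
    have h2 : siteNorm y ≤ |(y 0 : ℝ)| + |(y 1 : ℝ)| := by
      rw [siteNorm, Fin.sum_univ_two]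
      refine Real.sqrt_le_iff.2 ⟨by positivity, ?_⟩
      nlinarith [sq_abs (y 0 : ℝ), sq_abs (y 1 : ℝ), abs_nonneg (y 0 : ℝ), abs_nonneg (y 1 : ℝ),
        mul_nonneg (abs_nonneg (y 0 : ℝ)) (abs_nonneg (y 1 : ℝ))]
    have h3 : (4 * Real.pi)⁻¹ * siteNorm y ≤ (4 * Real.pi)⁻¹ * (|(y 0 : ℝ)| + |(y 1 : ℝ)|) := by
      gcongr
    have h4 : (4 * Real.pi)⁻¹ = (2 * Real.pi)⁻¹ / 2 := by
      field_simp
      norm_num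
    rw [h4] at h3 ⊢
    have := h1 0
    have := h1 1
    linarith
  have hcoc : Tendsto (fun n => L (y n)) atTop (cocompact _) := by
    rw [← Metric.cobounded_eq_cocompact, ← tendsto_norm_atTop_iff_cobounded]
    exact tendsto_atTop_mono (fun n => hLnorm (y n)) (hy.const_mul_atTop (by positivity))
  refine ((tendsto_integral_exp_smul_cocompact f volume).comp hcoc).congr fun n => ?_
  refine integral_congr_ae (Eventually.of_forall fun k => ?_)
  simp only [Circle.smul_def, smul_eq_mul, Real.fourierChar_apply]
  congr 2
  rw [hL]
  push_cast
  have : (Real.pi : ℂ) ≠ 0 := Complex.ofReal_ne_zero.2 Real.pi_ne_zero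
  field_simp

/-- The remainder, up to the factor `v / (4 π²)`. -/
noncomputable def remainder (A : Site → Site → ℝ) (What : Matrix (Fin 2) (Fin 2) ℝ) (τ s : ℝ)
    (y : Site) : ℂ :=
  ∫ k, Complex.exp (-Complex.I * ((toVec y ⬝ᵥ k : ℝ) : ℂ)) * diffPart A What τ s k

theorem aestronglyMeasurable_diffPart (hA : DriftProperties A What) (τ s : ℝ) :
    AEStronglyMeasurable (diffPart A What τ s) :=
  (aestronglyMeasurable_latticePart hA τ s).sub (aestronglyMeasurable_gaussPart What τ s)

theorem ae_ne_zero : ∀ᵐ k : Fin 2 → ℝ, k ≠ 0 := by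
  rw [ae_iff]
  simp

theorem norm_integral_cexp_site_mul_le (y : Site) (f : (Fin 2 → ℝ) → ℂ) :
    ‖∫ k, Complex.exp (-Complex.I * ((toVec y ⬝ᵥ k : ℝ) : ℂ)) * f k‖ ≤ ∫ k, ‖f k‖ := by
  refine (norm_integral_le_integral_norm _).trans (le_of_eq ?_)
  simp_rw [norm_mul, norm_cexp_site, one_mul]

theorem integrable_cexp_site_mul (y : Site) {f : (Fin 2 → ℝ) → ℂ} (hf : Integrable f) :
    Integrable fun k => Complex.exp (-Complex.I * ((toVec y ⬝ᵥ k : ℝ) : ℂ)) * f k :=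
  hf.bdd_mul (c := 1) (continuous_cexp_site y).aestronglyMeasurable
    (Eventually.of_forall fun k => (norm_cexp_site y k).le)

theorem integrable_diffPart (hA : DriftProperties A What) {τ s : ℝ} (hτ : 0 ≤ τ) (hs : 0 ≤ s) :
    Integrable (diffPart A What τ s) := by
  obtain ⟨G, hG, hdom⟩ := exists_dominating hA
  exact hG.mono' (aestronglyMeasurable_diffPart hA τ s)
    (ae_ne_zero.mono fun k hk => hdom τ s hτ hs k hk)

theorem exists_remainder_bound (hA : DriftProperties A What) :
    ∃ K : ℝ, ∀ τ s : ℝ, 0 ≤ τ → 0 ≤ s → ∀ y, ‖remainder A What τ s y‖ ≤ K := by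
  obtain ⟨G, hG, hdom⟩ := exists_dominating hA
  refine ⟨∫ k, G k, fun τ s hτ hs y => (norm_integral_cexp_site_mul_le y _).trans ?_⟩
  exact integral_mono_ae (integrable_diffPart hA hτ hs).norm hG
    (ae_ne_zero.mono fun k hk => hdom τ s hτ hs k hk)

/-- The remainder vanishes along sequences whose times converge in `[0, ∞]`. -/
theorem tendsto_remainder (hA : DriftProperties A What) {τ s : ℕ → ℝ} {y : ℕ → Site} {θ σ : ℝ}
    (hτ0 : ∀ n, 0 ≤ τ n) (hs0 : ∀ n, 0 ≤ s n)
    (hmax : Tendsto (fun n => max (τ n) (siteNorm (y n))) atTop atTop)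
    (hτ : Tendsto (fun n => Real.exp (-τ n)) atTop (𝓝 θ))
    (hs : Tendsto (fun n => Real.exp (-s n)) atTop (𝓝 σ)) :
    Tendsto (fun n => remainder A What (τ n) (s n) (y n)) atTop (𝓝 0) := by
  obtain ⟨G, hG, hdom⟩ := exists_dominating hA
  have hmeas : ∀ n, AEStronglyMeasurable (diffPart A What (τ n) (s n)) := fun n =>
    aestronglyMeasurable_diffPart hA _ _
  -- `θ = 0` means `τ → ∞`. Otherwise `τ` converges, so the maximum can diverge only through `y`;
  -- the integrand is then compared in `L¹` with a fixed limit `f`, to which Riemann–Lebesgue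
  -- applies.
  by_cases hθ : θ = 0
  · subst hθ
    have hinf : Tendsto τ atTop atTop := by
      exact tendsto_neg_atBot_iff.1 (Real.tendsto_exp_comp_nhds_zero.1 hτ)
    have h1 : Tendsto (fun n => ∫ k, ‖diffPart A What (τ n) (s n) k‖) atTop (𝓝 0) := by
      have h := tendsto_integral_of_dominated_convergence
        (F := fun n k => ‖diffPart A What (τ n) (s n) k‖) (f := fun _ => (0 : ℝ)) G
        (fun n => (hmeas n).norm) hG
        (fun n => ae_ne_zero.mono fun k hk => by
          rw [norm_norm]; exact hdom _ _ (hτ0 n) (hs0 n) k hk)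
        (ae_ne_zero.mono fun k hk => by
          simpa using (tendsto_diffPart_zero hA hinf hs0 hk).norm)
      simpa using h
    exact squeeze_zero_norm (fun n => norm_integral_cexp_site_mul_le _ _) h1
  · have hτlim : Tendsto τ atTop (𝓝 (-Real.log θ)) := by
      have h := ((Real.continuousAt_log hθ).tendsto.comp hτ).neg
      refine h.congr fun n => ?_
      simp
    have hy : Tendsto (fun n => siteNorm (y n)) atTop atTop := by
      rw [tendsto_atTop]
      intro b
      have h1 := hτlim.eventually (eventually_lt_nhds (lt_add_one (-Real.log θ)))
      have h2 := hmax.eventually_ge_atTop (max b (-Real.log θ + 1))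
      filter_upwards [h1, h2] with n hn1 hn2
      rcases le_max_iff.1 hn2 with h | h
      · exact absurd ((le_max_right _ _).trans h) (not_le.2 hn1)
      · exact (le_max_left _ _).trans h
    obtain ⟨f, hf⟩ := exists_tendsto_diffPart hA hτlim hs
    have hfm : AEStronglyMeasurable f := aestronglyMeasurable_of_tendsto_ae atTop hmeas
      (ae_ne_zero.mono fun k hk => hf k hk)
    have hfG : ∀ k, k ≠ 0 → ‖f k‖ ≤ G k := fun k hk =>
      le_of_tendsto (hf k hk).norm (Eventually.of_forall fun n => hdom _ _ (hτ0 n) (hs0 n) k hk)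
    have hfi : Integrable f := hG.mono' hfm (ae_ne_zero.mono fun k hk => hfG k hk)
    have h1 : Tendsto (fun n => ∫ k, ‖diffPart A What (τ n) (s n) k - f k‖) atTop (𝓝 0) := by
      have h := tendsto_integral_of_dominated_convergence
        (F := fun n k => ‖diffPart A What (τ n) (s n) k - f k‖) (f := fun _ => (0 : ℝ))
        (fun k => G k + G k) (fun n => ((hmeas n).sub hfm).norm) (hG.add hG)
        (fun n => ae_ne_zero.mono fun k hk => by
          rw [norm_norm]
          exact (norm_sub_le _ _).trans
            (add_le_add (hdom _ _ (hτ0 n) (hs0 n) k hk) (hfG k hk)))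
        (ae_ne_zero.mono fun k hk => by
          simpa using ((hf k hk).sub_const (f k)).norm)
      simpa using h
    have h2 := (squeeze_zero_norm (fun n => norm_integral_cexp_site_mul_le (y n) _) h1).add
      (tendsto_integral_cexp_site f hy)
    rw [add_zero] at h2
    refine h2.congr fun n => ?_
    have hi : Integrable fun k => diffPart A What (τ n) (s n) k - f k :=
      (integrable_diffPart hA (hτ0 n) (hs0 n)).sub hfi
    rw [← integral_add (integrable_cexp_site_mul _ hi) (integrable_cexp_site_mul _ hfi), remainder]
    congr 1
    funext k
    ring

/-- Uniformity by contradiction: along a sequence of counterexamples the pairs `(e^{-τ}, e^{-s})`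
lie in the compact square `[0, 1]²`, and a convergent subsequence contradicts `tendsto_remainder`.
-/
theorem exists_remainder_lt (hA : DriftProperties A What) {ε : ℝ} (hε : 0 < ε) :
    ∃ r : ℝ, ∀ τ s : ℝ, 0 ≤ τ → 0 ≤ s → ∀ y, r ≤ max τ (siteNorm y) →
      ‖remainder A What τ s y‖ < ε := by
  by_contra! h
  choose τ s hτ0 hs0 y hmax hge using fun n : ℕ => h n
  have hmem : ∀ n, (Real.exp (-τ n), Real.exp (-s n)) ∈ Set.Icc (0 : ℝ) 1 ×ˢ Set.Icc (0 : ℝ) 1 :=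
    fun n => ⟨⟨(Real.exp_pos _).le, Real.exp_le_one_iff.2 (neg_nonpos.2 (hτ0 n))⟩,
      ⟨(Real.exp_pos _).le, Real.exp_le_one_iff.2 (neg_nonpos.2 (hs0 n))⟩⟩
  obtain ⟨⟨θ, σ⟩, -, φ, hφ, hlim⟩ := (isCompact_Icc.prod isCompact_Icc).tendsto_subseq hmem
  rw [nhds_prod_eq] at hlim
  have hm : Tendsto (fun n => max (τ (φ n)) (siteNorm (y (φ n)))) atTop atTop :=
    (tendsto_atTop_mono hmax tendsto_natCast_atTop_atTop).comp hφ.tendsto_atTop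
  have hlim' := tendsto_remainder hA (fun n => hτ0 (φ n)) (fun n => hs0 (φ n)) hm hlim.fst hlim.snd
  have h0 : ε ≤ 0 := by
    refine ge_of_tendsto' (by simpa using hlim'.norm) fun n => hge (φ n)
  linarith

theorem limitCov_sub_leadingTerm {V : Matrix (Fin 2) (Fin 2) ℝ} {w : ℝ}
    (hA : DriftProperties A What) (hw : 0 < w)
    (hw2 : w ^ 2 = What.det) (hV : V * What * Vᵀ = -1) (v : ℝ) (y : Site) {t s : ℝ≥0}
    (hst : s ≤ t) :
    limitCov A v y t s - leadingTerm A V v w t s y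
      = v / (4 * Real.pi ^ 2) * (remainder A What (t - s) s y).re := by
  have hτ : 0 ≤ (t : ℝ) - s := sub_nonneg.2 hst
  have hg : Integrable (gaussPart A What (t - s) s) :=
    integrable_gaussPart hA.negDef hτ s.coe_nonneg
  have hd := integrable_diffPart hA hτ s.coe_nonneg
  -- Integrability of the lattice part follows from that of the difference and of the Gaussian part.
  have hl : Integrable (latticePart A (t - s) s) := by
    refine (hd.add hg).congr (Eventually.of_forall fun k => ?_)
    simp [diffPart]
  rw [limitCov_eq v y hst, leadingTerm_eq hA.negDef hw hw2 hV v y hst, ← mul_sub, ← Complex.sub_re,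
    ← integral_sub (integrable_cexp_site_mul y hl) (integrable_cexp_site_mul y hg), remainder]
  congr 3
  funext k
  rw [diffPart]
  ring

end Limits

end LinSDE

/-! ### Assembly of the theorem. -/

theorem theorem4p1
    (A : LinSDE.Site → LinSDE.Site → ℝ) (What V : Matrix (Fin 2) (Fin 2) ℝ) (v w : ℝ)
    (hA : LinSDE.DriftProperties A What)
    (hv : 0 < v)
    (hw : 0 < w) (hw2 : w ^ 2 = What.det)
    (hV : V * What * Vᵀ = -1) :
    ∃ (Wm : ℕ → ℕ → LinSDE.Site → ℝ≥0 → ℝ≥0 → ℝ)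
      (Winf : LinSDE.Site → ℝ≥0 → ℝ≥0 → ℝ)
      (j : ℝ≥0 → ℝ≥0 → LinSDE.Site → ℝ),
      -- the covariance is well defined, and depends neither on the initial condition nor on `p`
      (∀ m m₂ : ℕ, 0 < m₂ → m₂ < m →
        ∀ (Ω : Type*) [MeasurableSpace Ω] (μ : Measure Ω) [IsProbabilityMeasure μ]
          (ξbar : LinSDE.Torus m m₂ → ℝ) (ξ : LinSDE.Torus m m₂ → ℝ≥0 → Ω → ℝ),
          LinSDE.IsSolution μ A v m m₂ ξbar ξ →
            (∀ p t, MemLp (ξ p t) 2 μ) ∧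
            ∀ (p : LinSDE.Torus m m₂) (y : LinSDE.Site) (t s : ℝ≥0),
              LinSDE.covW μ ξ p (p + (QuotientAddGroup.mk y : LinSDE.Torus m m₂)) t s
                = Wm m m₂ y t s) ∧
      -- it converges as `m → ∞`, however `m₂` depends on `m`
      (∀ m₂ : ℕ → ℕ, (∀ᶠ m in atTop, 0 < m₂ m ∧ m₂ m < m) →
        ∀ (y : LinSDE.Site) (t s : ℝ≥0),
          Tendsto (fun m => Wm m (m₂ m) y t s) atTop (𝓝 (Winf y t s))) ∧
      -- the asymptotic form of the limit
      (∀ (y : LinSDE.Site) (t s : ℝ≥0), s ≤ t →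
        Winf y t s = LinSDE.leadingTerm A V v w t s y + j t s y) ∧
      (∃ K : ℝ, ∀ (t s : ℝ≥0) (y : LinSDE.Site), s ≤ t → |j t s y| ≤ K) ∧
      (∀ ε : ℝ, 0 < ε → ∃ r : ℝ, ∀ (t s : ℝ≥0) (y : LinSDE.Site), s ≤ t →
        r ≤ max ((t : ℝ) - s) (LinSDE.siteNorm y) → |j t s y| < ε) := by
  have hc : 0 < v / (4 * Real.pi ^ 2) := by positivity
  have hdiff : ∀ (t s : ℝ≥0) (y : LinSDE.Site), s ≤ t →
      |LinSDE.limitCov A v y t s - LinSDE.leadingTerm A V v w t s y|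
        ≤ v / (4 * Real.pi ^ 2) * ‖LinSDE.remainder A What (t - s) s y‖ := by
    intro t s y hst
    rw [LinSDE.limitCov_sub_leadingTerm hA hw hw2 hV v y hst, abs_mul, abs_of_pos hc]
    gcongr
    exact Complex.abs_re_le_norm _
  refine ⟨LinSDE.finiteCov A v, LinSDE.limitCov A v,
    fun t s y => LinSDE.limitCov A v y t s - LinSDE.leadingTerm A V v w t s y,
    fun m m₂ hm₂ hm Ω _ μ _ ξbar ξ h =>
      LinSDE.memLp_and_covW_eq_finiteCov hA.summable hv.le (hm₂.trans hm) h,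
    fun m₂ _ y t s => LinSDE.tendsto_finiteCov hA.summable v m₂ y t s,
    fun y t s _ => by ring, ?_, fun ε hε => ?_⟩
  · obtain ⟨K, hK⟩ := LinSDE.exists_remainder_bound hA
    refine ⟨v / (4 * Real.pi ^ 2) * K, fun t s y hst => (hdiff t s y hst).trans ?_⟩
    gcongr
    exact hK _ _ (sub_nonneg.2 hst) s.coe_nonneg y
  · obtain ⟨r, hr⟩ := LinSDE.exists_remainder_lt hA (div_pos hε hc)
    refine ⟨r, fun t s y hst hmax => (hdiff t s y hst).trans_lt ?_⟩
    have h := hr _ _ (sub_nonneg.2 hst) s.coe_nonneg y hmax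
    rwa [lt_div_iff₀ hc, mul_comm] at h
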